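/- Let $\mathfrak g$ be a finite-dimensional split simple Lie algebra over a field of characteristic $0$ (for instance a complex simple Lie algebra), $\mathfrak h$ a splitting Cartan subalgebra, and identify the root system of $(\mathfrak g,\mathfrak h)$ with a reduced crystallographic root system $\Phi_0$ in a Euclidean space $V$, with simple system $\Delta_0$ and positive roots $\Phi_0^+$ ordered by $\alpha\preceq\beta$ iff $\beta-\alpha$ is a sum (possibly empty) of simple roots. Let $\mathfrak b=\mathfrak h\oplus\bigoplus_{\alpha\in\Phi_0^+}\mathfrak g_\alpha$, and let $\mathcal J$ be an ad-nilpotent ideal of $\mathfrak b$, that is, an ideal of $\mathfrak b$ contained in $[\mathfrak b,\mathfrak b]$. Let $\Phi_{\mathcal J}$ be the set of $\alpha\in\Phi_0^+$ with $\mathfrak g_\alpha\subseteq\mathcal J$, let $(\Phi_{\mathcal J})_{\min}$ be the set of its $\preceq$-minimal elements, and put $$\mathcal R_{\mathcal J}=\{x\in C_\circ : \text{for all }\beta\in\Phi_0^+,\ \langle\beta,x\rangle>1 \text{ if } \alpha\preceq\beta \text{ for some } \alpha\in(\Phi_{\mathcal J})_{\min},\ \langle\beta,x\rangle<1\text{ otherwise}\},$$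 where $C_\circ=\{x\in V:\langle x,\alpha\rangle>0\ \forall\alpha\in\Delta_0\}$. Let $W=Q^\vee\rtimes W_0$ be the affine Weyl group, generated by the reflections of $V$ in the hyperplanes $H_{\alpha,k}=\{x:\langle x,\alpha\rangle=k\}$ $(\alpha\in\Phi_0^+,k\in\mathbb Z)$. For $w\in W$ let $A_w=wA_\circ$ be its alcove, where $A_\circ=\{x:0<\langle x,\alpha\rangle<1\ \forall\alpha\in\Phi_0^+\}$; let $k(w,\alpha)$ be the integer with $k(w,\alpha)<\langle x,\alpha\rangle<k(w,\alpha)+1$ for all $x\in A_w$, and let $X(w,\alpha)\in\{-,0,+\}$ be its sign. The Shi regions are the connected components of $V\setminus\bigcup_{\alpha\in\Phi_0^+}(H_{\alpha,0}\cup H_{\alpha,1})$; a Shi region is dominant if it is contained in $C_\circ$; and the sign type $X(\mathcal R)$ of a Shi region $\mathcal R$ is given by $X(\mathcal R,\alpha)=X(w,\alpha)$ for any $w\in W$ with $A_w\subseteq\mathcal R$. In $V\oplus\mathbb R\delta$, where $v+c\delta$ stands for the affine function $x\mapsto\langle v,x\rangle+c$ on $V$ and $W$ acts by $f\mapsto f\circ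 w^{-1}$, let $\Phi^+=(\Phi_0^++\mathbb N\delta)\sqcup(-\Phi_0^++\mathbb N^*\delta)$ and $N(w)=\Phi^+\cap w(-\Phi^+)$. Put $\Phi_{\mathcal J}^1=\Phi_{\mathcal J}$ and $\Phi_{\mathcal J}^{k}=\{\alpha+\beta\in\Phi_0^+ : \alpha\in\Phi_{\mathcal J}^{k-1},\beta\in\Phi_{\mathcal J}\}$ for $k\ge2$. Then $\mathcal J=\bigoplus_{\alpha\in\Phi_{\mathcal J}}\mathfrak g_\alpha$, and there is a unique element $w_{\mathcal J}\in W$ with $N(w_{\mathcal J})=\bigcup_{k\ge1}(k\delta-\Phi_{\mathcal J}^k)$. There is a unique Shi region containing the alcove $A_{w_{\mathcal J}}$; it is dominant and is equal to $\mathcal R_{\mathcal J}$. Moreover, for $\alpha\in\Phi_0^+$, $X(\mathcal R_{\mathcal J},\alpha)=+$ if $\alpha\in\Phi_{\mathcal J}$ and $X(\mathcal R_{\mathcal J},\alpha)=0$ if $\alpha\notin\Phi_{\mathcal J}$. -/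

import Mathlib

open scoped InnerProductSpace

noncomputable section

section Euclidean

variable {V : Type*} [NormedAddCommGroup V] [InnerProductSpace ℝ V]

/-- A reduced crystallographic root system `roots` (written `Φ₀` below) in a Euclidean space `V`,
together with a simple system `simple` (written `Δ₀` below). -/
structure EuclideanRootSystem (V : Type*) [NormedAddCommGroup V] [InnerProductSpace ℝ V] where
  roots : Set V
  simple : Set V
  finite_roots : roots.Finite
  span_roots : Submodule.span ℝ roots = ⊤
  zero_notMem : (0 : V) ∉ roots
  reflection_mem : ∀ α ∈ roots, ∀ β ∈ roots,
    β - (2 * ⟪β, α⟫_ℝ / ⟪α, α⟫_ℝ) • α ∈ roots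
  integral : ∀ α ∈ roots, ∀ β ∈ roots, ∃ n : ℤ, 2 * ⟪β, α⟫_ℝ / ⟪α, α⟫_ℝ = n
  reduced : ∀ α ∈ roots, ∀ c : ℝ, c • α ∈ roots → c = 1 ∨ c = -1
  simple_subset : simple ⊆ roots
  linearIndependent_simple : LinearIndependent ℝ (Subtype.val : simple → V)
  mem_or_neg_mem : ∀ α ∈ roots,
    α ∈ AddSubmonoid.closure simple ∨ -α ∈ AddSubmonoid.closure simple

namespace EuclideanRootSystem

variable (R : EuclideanRootSystem V)

/-- The positive roots `Φ₀⁺`: the roots which are sums of simple roots. -/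
def pos : Set V := {α ∈ R.roots | α ∈ AddSubmonoid.closure R.simple}

/-- The order `α ⪯ β` of the root poset: `β - α` is a sum (possibly empty) of simple roots. -/
def RootLE (α β : V) : Prop := β - α ∈ AddSubmonoid.closure R.simple

/-- The set `Ψ_min` of minimal elements of a set `Ψ` of positive roots. -/
def minimalRoots (Ψ : Set V) : Set V := {α ∈ Ψ | ∀ β ∈ Ψ, R.RootLE β α → α = β}

/-! ### The affine Weyl group -/

/-- The coroot `α^∨ = 2 α / ⟨α, α⟩`. -/
def coroot (α : V) : V := (2 / ⟪α, α⟫_ℝ) • α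

/-- The hyperplane `H_{α,k} = {x | ⟨x, α⟩ = k}`. -/
def hyperplane (α : V) (k : ℤ) : Set V := {x | ⟪x, α⟫_ℝ = k}

/-- The orthogonal reflection `s_{α,k}` in `H_{α,k}`: the linear reflection in `α`, followed by
the translation by `k α^∨`. See `affineReflection_apply`. -/
def affineReflection (α : V) (k : ℤ) : V ≃ᵃⁱ[ℝ] V :=
  AffineIsometryEquiv.constVAdd ℝ V ((k : ℝ) • coroot α) *
    ((ℝ ∙ α)ᗮ.reflection).toAffineIsometryEquiv

theorem affineReflection_apply (α : V) (k : ℤ) (x : V) :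
    affineReflection α k x = x - (⟪x, α⟫_ℝ - k) • coroot α := by
  have h : affineReflection α k x = (k : ℝ) • coroot α + (ℝ ∙ α)ᗮ.reflection x := rfl
  rw [h, Submodule.reflection_orthogonal_apply, Submodule.reflection_singleton_apply, coroot,
    real_inner_self_eq_norm_sq, real_inner_comm]
  simp only [RCLike.ofReal_real_eq_id, id_eq]
  module

/-- The affine Weyl group `W = Q^∨ ⋊ W₀`, acting on `V`: the group generated by the reflections
in the hyperplanes `H_{α,k}`, for `α` a root and `k` an integer. -/
def affineWeylGroup : Subgroup (V ≃ᵃⁱ[ℝ] V) :=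
  Subgroup.closure {s | ∃ α ∈ R.roots, ∃ k : ℤ, s = affineReflection α k}

/-- The fundamental chamber `C_∘` of the finite Weyl group. -/
def chamber : Set V := {x | ∀ α ∈ R.simple, 0 < ⟪x, α⟫_ℝ}

/-- The fundamental alcove `A_∘`. -/
def fundamentalAlcove : Set V := {x | ∀ α ∈ R.pos, 0 < ⟪x, α⟫_ℝ ∧ ⟪x, α⟫_ℝ < 1}

/-- The alcove `A_w = w A_∘` of an element of the affine Weyl group. -/
def alcove (w : R.affineWeylGroup) : Set V := (w : V ≃ᵃⁱ[ℝ] V) '' R.fundamentalAlcove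

/-- The Shi coefficient `k(w, α)`: the integer `k` such that `k < ⟨x, α⟩ < k + 1` for all `x` in
the alcove `A_w`. -/
def shiCoeff (w : R.affineWeylGroup) (α : V) : ℤ :=
  Classical.epsilon fun k : ℤ => ∀ x ∈ R.alcove w, (k : ℝ) < ⟪x, α⟫_ℝ ∧ ⟪x, α⟫_ℝ < k + 1

/-- The sign type `ζ(w) = (X(w, α))_α`, where `X(w, α)` is the sign of `k(w, α)`. -/
def signType (w : R.affineWeylGroup) (α : R.pos) : SignType :=
  SignType.sign (R.shiCoeff w (α : V))

/-! ### Shi regions -/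

/-- The complement in `V` of the hyperplanes `H_{α,0}` and `H_{α,1}` of the Shi arrangement. -/
def shiComplement : Set V :=
  {x | ∀ α ∈ R.pos, x ∉ hyperplane α 0 ∧ x ∉ hyperplane α 1}

/-- A Shi region is a connected component of the complement of the Shi arrangement. -/
def IsShiRegion (S : Set V) : Prop :=
  ∃ x ∈ R.shiComplement, S = connectedComponentIn R.shiComplement x

/-- A region is dominant if it is included in the fundamental chamber. -/
def IsDominant (S : Set V) : Prop := S ⊆ R.chamber

/-- The sign type of the region `S` is `X`: there is an alcove `A_w` in `S`, and every `w` with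
`A_w ⊆ S` has sign type `X`. -/
def HasSignType (S : Set V) (X : R.pos → SignType) : Prop :=
  (∃ w, R.alcove w ⊆ S) ∧ ∀ w, R.alcove w ⊆ S → R.signType w = X

/-- The region `R_A` attached by Postnikov to a set `A` (usually an antichain) of positive
roots. -/
def postnikovRegion (A : Set V) : Set V :=
  {x ∈ R.chamber | ∀ β ∈ R.pos,
    ((∃ α ∈ A, R.RootLE α β) → 1 < ⟪β, x⟫_ℝ) ∧ ((¬ ∃ α ∈ A, R.RootLE α β) → ⟪β, x⟫_ℝ < 1)}

/-! ### The affine root system and inversion sets -/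

/-- The positive affine roots `Φ⁺ = (Φ₀⁺ + ℕ δ) ⊔ (Φ₀⁻ + ℕ^* δ)` in `V ⊕ ℝ δ`; the pair
`(α, c)` stands for `α + c δ`. -/
def affinePos : Set (V × ℝ) :=
  {γ | ∃ α ∈ R.pos, ∃ n : ℕ, γ = (α, (n : ℝ)) ∨ γ = (-α, (n : ℝ) + 1)}

/-- The action on `V ⊕ ℝ δ` of an affine isometry `w` of `V`. Regarding `v + c δ` as the affine
function `x ↦ ⟨v, x⟩ + c` on `V`, this is `f ↦ f ∘ w⁻¹`
(see `affineAction_eval`); the reflection `s_{α,-k}` acts as the reflection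
`λ ↦ λ - ⟨λ, α^∨⟩ (α + k δ)` in the affine root `α + k δ`
(see `affineAction_affineReflection`). -/
def affineAction (w : V ≃ᵃⁱ[ℝ] V) (γ : V × ℝ) : V × ℝ :=
  (w.linearIsometryEquiv γ.1, γ.2 - ⟪w.linearIsometryEquiv γ.1, w 0⟫_ℝ)

theorem affineAction_eval (w : V ≃ᵃⁱ[ℝ] V) (γ : V × ℝ) (x : V) :
    ⟪(affineAction w γ).1, w x⟫_ℝ + (affineAction w γ).2 = ⟪γ.1, x⟫_ℝ + γ.2 := by
  have h : w x = w.linearIsometryEquiv x + w 0 := by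
    have := w.map_vadd 0 x
    simpa using this
  simp only [affineAction, h, inner_add_right, LinearIsometryEquiv.inner_map_map]
  ring

theorem affineAction_affineReflection (α : V) (k : ℤ) (γ : V × ℝ) :
    affineAction (affineReflection α (-k)) γ =
      γ - ⟪γ.1, coroot α⟫_ℝ • (α, (k : ℝ)) := by
  have hl : (affineReflection α (-k)).linearIsometryEquiv γ.1 = γ.1 - ⟪γ.1, α⟫_ℝ • coroot α := by
    have h := (affineReflection α (-k)).map_vadd 0 γ.1
    simp only [vadd_eq_add, add_zero, affineReflection_apply, inner_zero_left] at h
    rw [eq_sub_of_add_eq h.symm]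
    module
  rcases eq_or_ne α 0 with rfl | hα
  · ext1
    · simp [affineAction, hl, coroot]
    · simp [affineAction, hl, coroot, affineReflection_apply]
  have hn : ⟪α, α⟫_ℝ ≠ 0 := by simpa using hα
  ext1
  · simp only [affineAction, hl, coroot, inner_smul_right, Prod.fst_sub, Prod.smul_fst]
    module
  · simp only [affineAction, hl, coroot, affineReflection_apply, inner_smul_right, inner_sub_left,
      inner_smul_left, inner_zero_left, Prod.snd_sub, Prod.smul_snd, zero_sub, inner_neg_right,
      Int.cast_neg, smul_eq_mul, RCLike.conj_to_real]
    field_simp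
    ring

/-- The inversion set `N(w) = Φ⁺ ∩ w(Φ⁻)`, where `Φ⁻ = -Φ⁺`. -/
def inversionSet (w : R.affineWeylGroup) : Set (V × ℝ) :=
  R.affinePos ∩ affineAction (w : V ≃ᵃⁱ[ℝ] V) '' {γ | -γ ∈ R.affinePos}

/-- The bracket `[Ψ₁, Ψ₂] = {α₁ + α₂ ∈ Φ₀⁺ | αᵢ ∈ Ψᵢ}`. -/
def bracket (Ψ₁ Ψ₂ : Set V) : Set V :=
  {γ ∈ R.pos | ∃ α₁ ∈ Ψ₁, ∃ α₂ ∈ Ψ₂, γ = α₁ + α₂}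

/-- The powers of a set of roots with a shifted index: `bracketPow Ψ n` is `Ψ^(n + 1)`, where
`Ψ^1 = Ψ` and `Ψ^k = [Ψ^(k-1), Ψ]`. -/
def bracketPow (Ψ : Set V) : ℕ → Set V
  | 0 => Ψ
  | n + 1 => R.bracket (bracketPow Ψ n) Ψ

/-- The set `𝕃_Ψ = ⋃_{k ≥ 1} (k δ - Ψ^k)`. -/
def ellSet (Ψ : Set V) : Set (V × ℝ) :=
  {γ | ∃ n : ℕ, ∃ α ∈ R.bracketPow Ψ n, γ = (-α, (n : ℝ) + 1)}

end EuclideanRootSystem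

end Euclidean

section LieAlgebra

open LieAlgebra LieAlgebra.IsKilling

variable {K L : Type*} [Field K] [CharZero K] [LieRing L] [LieAlgebra K L] [FiniteDimensional K L]
  [IsKilling K L] {H : LieSubalgebra K L} [H.IsCartanSubalgebra]
  [LieModule.IsTriangularizable K H L]

/-- The functions on the Cartan subalgebra which are `0` or a positive root. -/
def borelWeights (b : (rootSystem H).Base) : Set (H → K) :=
  {χ | χ = 0 ∨ ∃ α : H.root, b.IsPos α ∧ χ = (α : LieModule.Weight K H L)}

/-- The sum of the root spaces for `0` and the positive roots is `𝔥 ⊕ ⨁_{α > 0} 𝔤_α`. -/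
theorem iSup_borelWeights (b : (rootSystem H).Base) :
    (⨆ χ ∈ borelWeights b, (rootSpace H χ).toSubmodule) =
      H.toSubmodule ⊔ ⨆ (α : H.root) (_ : b.IsPos α),
        (rootSpace H (α : LieModule.Weight K H L)).toSubmodule := by
  have h0 : H.toSubmodule = (rootSpace H (0 : H → K)).toSubmodule := by
    rw [LieAlgebra.rootSpace_zero_eq]
    rfl
  rw [h0]
  apply le_antisymm
  · refine iSup₂_le fun χ hχ => ?_
    rcases hχ with rfl | ⟨α, hα, rfl⟩
    · exact le_sup_left
    · exact le_sup_of_le_right (le_iSup₂_of_le α hα le_rfl)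
  · refine sup_le ?_ (iSup₂_le fun α hα => ?_)
    · exact le_iSup₂_of_le (0 : H → K) (Or.inl rfl) le_rfl
    · exact le_iSup₂_of_le (α : H → K) (Or.inr ⟨α, hα, rfl⟩) le_rfl

theorem lie_mem_borel (b : (rootSystem H).Base) {x y : L}
    (hx : x ∈ ⨆ χ ∈ borelWeights b, (rootSpace H χ).toSubmodule)
    (hy : y ∈ ⨆ χ ∈ borelWeights b, (rootSpace H χ).toSubmodule) :
    ⁅x, y⁆ ∈ ⨆ χ ∈ borelWeights b, (rootSpace H χ).toSubmodule := by
  have key : ∀ χ₁ ∈ borelWeights b, ∀ χ₂ ∈ borelWeights b, ∀ u ∈ rootSpace H χ₁,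
      ∀ v ∈ rootSpace H χ₂, ⁅u, v⁆ ∈ ⨆ χ ∈ borelWeights b, (rootSpace H χ).toSubmodule := by
    intro χ₁ h₁ χ₂ h₂ u hu v hv
    have huv : ⁅u, v⁆ ∈ rootSpace H (χ₁ + χ₂) :=
      LieAlgebra.lie_mem_genWeightSpace_of_mem_genWeightSpace hu hv
    have hmem : χ₁ + χ₂ ∈ borelWeights b →
        ⁅u, v⁆ ∈ ⨆ χ ∈ borelWeights b, (rootSpace H χ).toSubmodule := fun h =>
      (le_iSup₂_of_le (f := fun χ (_ : χ ∈ borelWeights b) => (rootSpace H χ).toSubmodule)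
        (χ₁ + χ₂) h le_rfl) huv
    rcases h₁ with rfl | ⟨α, hα, rfl⟩
    · exact hmem (by simpa using h₂)
    rcases h₂ with rfl | ⟨β, hβ, rfl⟩
    · exact hmem (by rw [add_zero]; exact Or.inr ⟨α, hα, rfl⟩)
    by_cases hbot : rootSpace H (⇑(α : LieModule.Weight K H L) + ⇑(β : LieModule.Weight K H L)) = ⊥
    · rw [hbot, LieSubmodule.mem_bot] at huv
      rw [huv]
      exact zero_mem _
    have hne : ¬ ((⟨_, hbot⟩ : LieModule.Weight K H L)).IsZero := by
      intro hz
      have hz' : ⇑(α : LieModule.Weight K H L) + ⇑(β : LieModule.Weight K H L) = 0 := hz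
      have hneg : (rootSystem H).root β = -(rootSystem H).root α := by
        ext h
        have := congrFun hz' h
        simp only [Pi.add_apply, Pi.zero_apply] at this
        simpa using eq_neg_of_add_eq_zero_right this
      have hh := RootPairing.Base.height_reflectionPerm_self b α
      have hβ' : β = (rootSystem H).reflectionPerm α α := by
        apply (rootSystem H).root.injective
        rw [hneg, RootPairing.root_reflectionPerm, RootPairing.reflection_apply_self]
      rw [RootPairing.Base.isPos_iff] at hα hβ
      rw [hβ'] at hβ
      have : b.height ((rootSystem H).reflectionPerm α α) = - b.height α := hh
      omega
    refine hmem (Or.inr ⟨⟨⟨_, hbot⟩, by simpa using hne⟩, ?_, rfl⟩)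
    refine RootPairing.Base.IsPos.add hα hβ ?_
    ext h
    simp
  induction hx using Submodule.iSup_induction' with
  | zero => simp
  | add u v _ _ hu hv => rw [add_lie]; exact add_mem hu hv
  | mem χ₁ u hu =>
    by_cases h₁ : χ₁ ∈ borelWeights b
    swap
    · simp [h₁] at hu
      simp [hu]
    simp only [h₁, iSup_pos] at hu
    induction hy using Submodule.iSup_induction' with
    | zero => simp
    | add v v' _ _ hv hv' => rw [lie_add]; exact add_mem hv hv'
    | mem χ₂ v hv =>
      by_cases h₂ : χ₂ ∈ borelWeights b
      swap
      · simp [h₂] at hv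
        simp [hv]
      simp only [h₂, iSup_pos] at hv
      exact key χ₁ h₁ χ₂ h₂ u hu v hv

/-- The Borel subalgebra `𝔟 = 𝔥 ⊕ ⨁_{α > 0} 𝔤_α` attached to a Cartan subalgebra `𝔥` and a simple
system. -/
def borelSubalgebra (b : (rootSystem H).Base) : LieSubalgebra K L where
  toSubmodule := H.toSubmodule ⊔ ⨆ (α : H.root) (_ : b.IsPos α),
    (rootSpace H (α : LieModule.Weight K H L)).toSubmodule
  lie_mem' := fun {x y} hx hy => by
    have hx' : x ∈ ⨆ χ ∈ borelWeights b, (rootSpace H χ).toSubmodule := by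
      rw [iSup_borelWeights]; exact hx
    have hy' : y ∈ ⨆ χ ∈ borelWeights b, (rootSpace H χ).toSubmodule := by
      rw [iSup_borelWeights]; exact hy
    have h := lie_mem_borel b hx' hy'
    rw [iSup_borelWeights] at h
    exact h

/-- An ideal of the Borel subalgebra is ad-nilpotent if it is contained in `[𝔟, 𝔟]`. -/
def IsAdNilpotentIdeal (b : (rootSystem H).Base) (J : LieIdeal K (borelSubalgebra b)) : Prop :=
  J ≤ ⁅(⊤ : LieIdeal K (borelSubalgebra b)), (⊤ : LieIdeal K (borelSubalgebra b))⁆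

/-- The ideal `J` of `𝔟`, as a subspace of the ambient Lie algebra. -/
def idealSubspace (b : (rootSystem H).Base) (J : LieIdeal K (borelSubalgebra b)) :
    Submodule K L :=
  J.toSubmodule.map (borelSubalgebra b).toSubmodule.subtype

variable {V : Type*} [NormedAddCommGroup V] [InnerProductSpace ℝ V]

/-- An identification of the roots of the Lie algebra (relative to `𝔥`, with the simple system
`b`) with the Euclidean root system `R` and its simple system: a bijection which respects
Cartan integers and simple roots. -/
structure RootIdentification (b : (rootSystem H).Base) (R : EuclideanRootSystem V) where
  toEquiv : H.root ≃ R.roots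
  pairing_eq : ∀ α β : H.root,
    2 * ⟪(toEquiv α : V), (toEquiv β : V)⟫_ℝ / ⟪(toEquiv β : V), (toEquiv β : V)⟫_ℝ =
      ((rootSystem H).pairingIn ℤ α β : ℝ)
  simple_iff : ∀ α : H.root, (toEquiv α : V) ∈ R.simple ↔ α ∈ b.support

/-- The set `Φ_J` of the positive roots whose root space is contained in `J`. -/
def idealRoots {b : (rootSystem H).Base} {R : EuclideanRootSystem V} (e : RootIdentification b R)
    (J : LieIdeal K (borelSubalgebra b)) : Set V :=
  {v | ∃ α : H.root, b.IsPos α ∧ v = e.toEquiv α ∧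
    (rootSpace H (α : LieModule.Weight K H L)).toSubmodule ≤ idealSubspace b J}

end LieAlgebra

end

open scoped InnerProductSpace

noncomputable section

namespace EuclideanRootSystem

/-! ### Finite root systems: root arithmetic, heights and the root poset. -/

section Roots

variable {V : Type*} [NormedAddCommGroup V] [InnerProductSpace ℝ V] (R : EuclideanRootSystem V)

/-! On the Lie algebra side, `J` is stable under `𝔥` and lies in the sum of the positive root
spaces, which are lines. Hence `J` is the sum of the root spaces it contains
(`IsAdNilpotentIdeal.idealSubspace_eq`), and sl₂-theory shows that Φ_J is closed under adding
positive roots (`isRootIdeal_idealRoots`). The rest concerns any such set Ψ.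

A finite set N of positive affine roots that is closed and coclosed under sums is some N(w)
(`exists_inversionSet_eq`): N contains a simple affine root α, and s_α(N \ {α}) is a smaller set of
the same kind. For 𝕃_Ψ, closedness says that a root a + b with a ∈ Ψ^k, b ∈ Ψ^l lies in Ψ^(k+l)
(`add_mem_bracketPow`); coclosedness rests on the converse, that a + b ∈ Ψ^(k+l) forces a ∈ Ψ^k or b
∈ Ψ^l (`mem_bracketPow_or_mem_bracketPow`). Uniqueness of w holds because only the identity of W
keeps the base point on the positive side of every positive affine root, a consequence of the
exchange property.

Finally, N(w) consists of the positive affine roots that are negative on A_w. No element of 𝕃_Ψ has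
δ-coefficient 0, and those with coefficient 1 are the δ - β with β ∈ Ψ. So A_w lies in the chamber,
with ⟨β, ·⟩ > 1 for β ∈ Ψ and < 1 otherwise. As Ψ is the upper set generated by its minimal
elements, these inequalities define R_J, a convex set which is a full component of the Shi
complement; they also fix the signs. -/

theorem ne_zero_of_mem_roots {α : V} (hα : α ∈ R.roots) : α ≠ 0 := by
  rintro rfl
  exact R.zero_notMem hα

theorem inner_self_pos {α : V} (hα : α ∈ R.roots) : 0 < ⟪α, α⟫_ℝ :=
  real_inner_self_pos.2 (R.ne_zero_of_mem_roots hα)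

theorem neg_mem_roots {α : V} (hα : α ∈ R.roots) : -α ∈ R.roots := by
  have h := R.reflection_mem α hα α hα
  have h0 := (R.inner_self_pos hα).ne'
  rw [mul_div_assoc, div_self h0] at h
  convert h using 1
  module

theorem neg_mem_roots_iff {α : V} : -α ∈ R.roots ↔ α ∈ R.roots :=
  ⟨fun h => by simpa using R.neg_mem_roots h, R.neg_mem_roots⟩

theorem sub_inner_coroot_smul_mem_roots {α β : V} (hα : α ∈ R.roots) (hβ : β ∈ R.roots) :
    β - ⟪β, coroot α⟫_ℝ • α ∈ R.roots := by
  have h := R.reflection_mem α hα β hβ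
  rwa [coroot, inner_smul_right, div_mul_eq_mul_div]

theorem exists_inner_coroot_eq {α β : V} (hα : α ∈ R.roots) (hβ : β ∈ R.roots) :
    ∃ n : ℤ, ⟪β, coroot α⟫_ℝ = n := by
  obtain ⟨n, hn⟩ := R.integral α hα β hβ
  exact ⟨n, by rw [← hn, coroot, inner_smul_right, div_mul_eq_mul_div]⟩

/-- Both Cartan integers are positive. If one of them is 1, the corresponding reflection yields the
difference up to sign. If both are at least 2, then ‖α‖² and ‖β‖² are at most ⟨α, β⟩, so ‖α - β‖² ≤
0. -/
theorem sub_mem_roots {α β : V} (hα : α ∈ R.roots) (hβ : β ∈ R.roots) (h : 0 < ⟪α, β⟫_ℝ)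
    (hne : α ≠ β) : α - β ∈ R.roots := by
  obtain ⟨n, hn⟩ := R.integral α hα β hβ
  obtain ⟨m, hm⟩ := R.integral β hβ α hα
  have ha := R.inner_self_pos hα
  have hb := R.inner_self_pos hβ
  have hsymm : ⟪β, α⟫_ℝ = ⟪α, β⟫_ℝ := real_inner_comm _ _
  have hr₁ := R.reflection_mem α hα β hβ
  have hr₂ := R.reflection_mem β hβ α hα
  rw [hn] at hr₁
  rw [hm] at hr₂
  rw [hsymm, div_eq_iff ha.ne'] at hn
  rw [div_eq_iff hb.ne'] at hm
  have hn0 : 0 < n := by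
    by_contra! hc
    have : (n : ℝ) ≤ 0 := by exact_mod_cast hc
    nlinarith
  have hm0 : 0 < m := by
    by_contra! hc
    have : (m : ℝ) ≤ 0 := by exact_mod_cast hc
    nlinarith
  rcases eq_or_ne n 1 with rfl | hn1
  · rw [Int.cast_one, one_smul] at hr₁
    simpa using R.neg_mem_roots hr₁
  rcases eq_or_ne m 1 with rfl | hm1
  · simpa using hr₂
  have hn2 : (2 : ℝ) ≤ n := by exact_mod_cast (by omega : 2 ≤ n)
  have hm2 : (2 : ℝ) ≤ m := by exact_mod_cast (by omega : 2 ≤ m)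
  have h1 : ⟪α, α⟫_ℝ ≤ ⟪α, β⟫_ℝ := by nlinarith
  have h2 : ⟪β, β⟫_ℝ ≤ ⟪α, β⟫_ℝ := by nlinarith
  have h3 : ⟪α - β, α - β⟫_ℝ ≤ 0 := by
    rw [inner_sub_left, inner_sub_right, inner_sub_right, hsymm]
    linarith
  exact absurd (sub_eq_zero.1 (real_inner_self_nonpos.1 h3)) hne

theorem add_mem_roots {α β : V} (hα : α ∈ R.roots) (hβ : β ∈ R.roots) (h : ⟪α, β⟫_ℝ < 0)
    (hne : α + β ≠ 0) : α + β ∈ R.roots := by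
  have := R.sub_mem_roots hα (R.neg_mem_roots hβ) (by rw [inner_neg_right]; linarith)
    (fun h => hne (by rw [h]; simp))
  simpa using this

/-- If `a + b` and `a + b + c` are roots, then one of `a + c` and `b + c` is a root. -/
theorem add_mem_roots_or_add_mem_roots {a b c : V} (ha : a ∈ R.roots) (hb : b ∈ R.roots)
    (hc : c ∈ R.roots) (hab : a + b ∈ R.roots) (habc : a + b + c ∈ R.roots) (hac0 : a + c ≠ 0)
    (hbc0 : b + c ≠ 0) : a + c ∈ R.roots ∨ b + c ∈ R.roots := by
  by_contra! hcon
  obtain ⟨h1, h2⟩ := hcon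
  have hac : 0 ≤ ⟪a, c⟫_ℝ := by
    by_contra! h
    exact h1 (R.add_mem_roots ha hc h hac0)
  have hbc : 0 ≤ ⟪b, c⟫_ℝ := by
    by_contra! h
    exact h2 (R.add_mem_roots hb hc h hbc0)
  have hga : ⟪a + b + c, a⟫_ℝ ≤ 0 := by
    by_contra! h
    refine h2 ?_
    have := R.sub_mem_roots habc ha h (fun he => hbc0 ?_)
    · rwa [show a + b + c - a = b + c by abel] at this
    · rwa [add_assoc, add_eq_left] at he
  have hgb : ⟪a + b + c, b⟫_ℝ ≤ 0 := by
    by_contra! h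
    refine h1 ?_
    have := R.sub_mem_roots habc hb h (fun he => hac0 ?_)
    · rwa [show a + b + c - b = a + c by abel] at this
    · rwa [show a + b + c = (a + c) + b by abel, add_eq_right] at he
  -- The two nonpositive products add up to ‖a + b‖² + ⟨a, c⟩ + ⟨b, c⟩, which is positive.
  have hpos := R.inner_self_pos hab
  have h3 : ⟪a + b + c, a⟫_ℝ + ⟪a + b + c, b⟫_ℝ
      = ⟪a + b, a + b⟫_ℝ + ⟪a, c⟫_ℝ + ⟪b, c⟫_ℝ := by
    rw [← inner_add_right, inner_add_left (a + b) c, inner_add_right c, real_inner_comm a c,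
      real_inner_comm b c]
    ring
  linarith

theorem simple_subset_pos : R.simple ⊆ R.pos := fun _ hα =>
  ⟨R.simple_subset hα, AddSubmonoid.subset_closure hα⟩

theorem mem_pos_or_neg_mem_pos {α : V} (hα : α ∈ R.roots) : α ∈ R.pos ∨ -α ∈ R.pos :=
  (R.mem_or_neg_mem α hα).imp (fun h => ⟨hα, h⟩) fun h => ⟨R.neg_mem_roots hα, h⟩

theorem add_mem_pos {α β : V} (hα : α ∈ R.pos) (hβ : β ∈ R.pos) (h : α + β ∈ R.roots) :
    α + β ∈ R.pos :=
  ⟨h, add_mem hα.2 hβ.2⟩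

theorem finite_pos : R.pos.Finite := R.finite_roots.subset fun _ h => h.1

/-! ### Heights of sums of simple roots. -/

section Height

variable [FiniteDimensional ℝ V]

theorem exists_inner_simple_eq_one : ∃ v : V, ∀ α ∈ R.simple, ⟪v, α⟫_ℝ = 1 := by
  have hli : LinearIndepOn ℝ id R.simple := R.linearIndependent_simple
  let B := Module.Basis.extend hli
  let f : V →ₗ[ℝ] ℝ := B.constr ℝ fun _ => (1 : ℝ)
  refine ⟨(InnerProductSpace.toDual ℝ V).symm (LinearMap.toContinuousLinearMap f), fun α hα => ?_⟩
  rw [InnerProductSpace.toDual_symm_apply]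
  have h : B ⟨α, hli.subset_extend _ hα⟩ = α := Module.Basis.extend_apply_self hli _
  change f α = 1
  rw [← h]
  exact B.constr_basis ℝ _ _

/-- A vector whose inner product with every simple root is `1`. -/
def heightVector : V := R.exists_inner_simple_eq_one.choose

theorem inner_heightVector_simple {α : V} (hα : α ∈ R.simple) : ⟪R.heightVector, α⟫_ℝ = 1 :=
  R.exists_inner_simple_eq_one.choose_spec α hα

theorem exists_nat_inner_heightVector {x : V} (hx : x ∈ AddSubmonoid.closure R.simple) :
    ∃ n : ℕ, ⟪R.heightVector, x⟫_ℝ = n ∧ (n = 0 → x = 0) := by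
  induction hx using AddSubmonoid.closure_induction with
  | mem x hx => exact ⟨1, by simp [R.inner_heightVector_simple hx]⟩
  | zero => exact ⟨0, by simp⟩
  | add x y _ _ hx hy =>
    obtain ⟨n, hn, hn0⟩ := hx
    obtain ⟨m, hm, hm0⟩ := hy
    refine ⟨n + m, by rw [inner_add_right, hn, hm]; push_cast; rfl, fun h => ?_⟩
    rw [hn0 (by omega), hm0 (by omega), add_zero]

/-- The height of a sum of simple roots. -/
def height (x : V) : ℕ := ⌊⟪R.heightVector, x⟫_ℝ⌋₊

theorem inner_heightVector_eq_height {x : V} (hx : x ∈ AddSubmonoid.closure R.simple) :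
    ⟪R.heightVector, x⟫_ℝ = R.height x := by
  obtain ⟨n, hn, -⟩ := R.exists_nat_inner_heightVector hx
  rw [height, hn, Nat.floor_natCast]

theorem eq_zero_of_height_eq_zero {x : V} (hx : x ∈ AddSubmonoid.closure R.simple)
    (h : R.height x = 0) : x = 0 := by
  obtain ⟨n, hn, h0⟩ := R.exists_nat_inner_heightVector hx
  refine h0 ?_
  rwa [height, hn, Nat.floor_natCast] at h

theorem height_add {x y : V} (hx : x ∈ AddSubmonoid.closure R.simple)
    (hy : y ∈ AddSubmonoid.closure R.simple) : R.height (x + y) = R.height x + R.height y := by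
  have h := R.inner_heightVector_eq_height (add_mem hx hy)
  rw [inner_add_right, R.inner_heightVector_eq_height hx, R.inner_heightVector_eq_height hy] at h
  exact_mod_cast h.symm

theorem height_simple {α : V} (hα : α ∈ R.simple) : R.height α = 1 := by
  simp [height, R.inner_heightVector_simple hα]

theorem height_pos {α : V} (hα : α ∈ R.pos) : 0 < R.height α := by
  by_contra! h
  exact R.ne_zero_of_mem_roots hα.1 (R.eq_zero_of_height_eq_zero hα.2 (by omega))

theorem add_ne_zero_of_mem_pos {α β : V} (hα : α ∈ R.pos)
    (hβ : β ∈ AddSubmonoid.closure R.simple) : α + β ≠ 0 := by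
  intro h
  have h1 := R.height_add hα.2 hβ
  have h2 := R.height_pos hα
  rw [h] at h1
  simp only [height, inner_zero_right, Nat.floor_zero] at h1 h2
  omega

theorem neg_notMem_pos {α : V} (hα : α ∈ R.pos) : -α ∉ R.pos := fun h =>
  R.add_ne_zero_of_mem_pos hα h.2 (add_neg_cancel α)

theorem RootLE.antisymm {α β : V} (h₁ : R.RootLE α β) (h₂ : R.RootLE β α) : α = β := by
  have h := R.height_add h₁ h₂
  have h0 : R.height (β - α + (α - β)) = 0 := by simp [height]
  rw [h0] at h
  exact (sub_eq_zero.1 (R.eq_zero_of_height_eq_zero h₁ (by omega))).symm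

end Height

theorem RootLE.refl (α : V) : R.RootLE α α := by simp [RootLE, zero_mem]

theorem RootLE.trans {α β γ : V} (h₁ : R.RootLE α β) (h₂ : R.RootLE β γ) : R.RootLE α γ := by
  have := add_mem h₁ h₂
  rwa [sub_add_sub_comm, add_comm β, add_sub_add_right_eq_sub] at this

/-- If every simple root occurring in an expression of x as a sum had nonpositive product with x,
summing over the expression would give ⟨x, x⟩ ≤ 0. -/
theorem exists_simple_inner_pos {x : V} (hx : x ∈ AddSubmonoid.closure R.simple) (h0 : x ≠ 0) :
    ∃ α ∈ R.simple, 0 < ⟪x, α⟫_ℝ ∧ x - α ∈ AddSubmonoid.closure R.simple := by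
  classical
  obtain ⟨l, hl, rfl⟩ := AddSubmonoid.exists_multiset_of_mem_closure hx
  by_contra! hcon
  have h1 : ∀ α ∈ l, ⟪l.sum, α⟫_ℝ ≤ 0 := by
    intro α hα
    by_contra! h
    refine hcon α (hl α hα) h ?_
    rw [← Multiset.cons_erase hα, Multiset.sum_cons, add_sub_cancel_left]
    exact AddSubmonoid.multiset_sum_mem _ _ fun y hy =>
      AddSubmonoid.subset_closure (hl y (Multiset.mem_of_mem_erase hy))
  have h2 : ∀ s : Multiset V, s ≤ l → ⟪l.sum, s.sum⟫_ℝ ≤ 0 := by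
    intro s
    induction s using Multiset.induction_on with
    | empty => simp
    | cons a s ih =>
      intro hs
      rw [Multiset.sum_cons, inner_add_right]
      have := ih ((Multiset.le_cons_self s a).trans hs)
      have := h1 a (Multiset.mem_of_le hs (Multiset.mem_cons_self a s))
      linarith
  exact h0 (real_inner_self_nonpos.1 (h2 l le_rfl))

/-- A set of positive roots is an upper set for `RootLE` if it is closed under the addition of
positive roots. -/
theorem mem_of_rootLE [FiniteDimensional ℝ V] {Ψ : Set V} (hpos : Ψ ⊆ R.pos)
    (hup : ∀ α ∈ Ψ, ∀ β ∈ R.pos, α + β ∈ R.roots → α + β ∈ Ψ) {α β : V} (hα : α ∈ Ψ)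
    (hβ : β ∈ R.pos) (h : R.RootLE α β) : β ∈ Ψ := by
  induction hn : R.height (β - α) generalizing α β with
  | zero => rwa [sub_eq_zero.1 (R.eq_zero_of_height_eq_zero h hn)]
  | succ n ih =>
    have h0 : β - α ≠ 0 := by
      intro h0
      simp [h0, height] at hn
    -- Since ⟨β, σ⟩ > ⟨α, σ⟩, either ⟨α, σ⟩ < 0 and one climbs from α to the root α + σ, or ⟨β, σ⟩ >
    -- 0 and one descends from β to the root β - σ. Both shorten β - α by σ.
    obtain ⟨σ, hσ, hin, hsub⟩ := R.exists_simple_inner_pos h h0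
    have hheight : R.height (β - α - σ) = n := by
      have := R.height_add hsub (AddSubmonoid.subset_closure hσ)
      rw [sub_add_cancel, hn, R.height_simple hσ] at this
      omega
    have hα' := hpos hα
    have hσ' := R.simple_subset_pos hσ
    rw [inner_sub_left] at hin
    by_cases hc : ⟪α, σ⟫_ℝ < 0
    · have hr : α + σ ∈ R.roots :=
        R.add_mem_roots hα'.1 hσ'.1 hc (R.add_ne_zero_of_mem_pos hα' hσ'.2)
      have he : β - (α + σ) = β - α - σ := by abel
      exact ih (hup α hα σ hσ' hr) hβ (by rw [RootLE, he]; exact hsub) (by rw [he, hheight])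
    · have hβσ : 0 < ⟪β, σ⟫_ℝ := by linarith
      have hne : β ≠ σ := by
        rintro rfl
        have := R.add_ne_zero_of_mem_pos hα' hsub
        exact this (by abel)
      have hr := R.sub_mem_roots hβ.1 hσ'.1 hβσ hne
      have he : β - σ - α = β - α - σ := by abel
      have hp : β - σ ∈ R.pos := ⟨hr, by
        rw [show β - σ = α + (β - α - σ) by abel]
        exact add_mem hα'.2 hsub⟩
      have := hup (β - σ) (ih hα hp (by rw [RootLE, he]; exact hsub) (by rw [he, hheight])) σ hσ'
        (by rw [sub_add_cancel]; exact hβ.1)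
      rwa [sub_add_cancel] at this

theorem exists_minimalRoots_rootLE [FiniteDimensional ℝ V] {Ψ : Set V} (hpos : Ψ ⊆ R.pos) {β : V}
    (hβ : β ∈ Ψ) : ∃ α ∈ R.minimalRoots Ψ, R.RootLE α β := by
  induction hn : R.height β using Nat.strong_induction_on generalizing β with
  | _ n ih =>
    by_cases hmin : β ∈ R.minimalRoots Ψ
    · exact ⟨β, hmin, RootLE.refl R β⟩
    · have : ∃ γ ∈ Ψ, R.RootLE γ β ∧ β ≠ γ := by
        by_contra! hc
        exact hmin ⟨hβ, hc⟩
      obtain ⟨γ, hγ, hle, hne⟩ := this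
      have h := R.height_add hle (hpos hγ).2
      rw [sub_add_cancel] at h
      have h0 : R.height (β - γ) ≠ 0 := fun h0 =>
        hne (sub_eq_zero.1 (R.eq_zero_of_height_eq_zero hle h0))
      obtain ⟨α, hα, hαγ⟩ := ih (R.height γ) (by omega) hγ rfl
      exact ⟨α, hα, RootLE.trans R hαγ hle⟩

end Roots

/-! ### Affine roots as affine functions, and their reflections. -/

section AffineRoots

variable {V : Type*} [NormedAddCommGroup V] [InnerProductSpace ℝ V]

/-- The value at `x` of the affine function `v + c δ`. -/
def affineEval (γ : V × ℝ) (x : V) : ℝ := ⟪γ.1, x⟫_ℝ + γ.2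

theorem affineEval_add (γ γ' : V × ℝ) (x : V) :
    affineEval (γ + γ') x = affineEval γ x + affineEval γ' x := by
  simp only [affineEval, Prod.fst_add, Prod.snd_add, inner_add_left]
  ring

theorem affineEval_neg (γ : V × ℝ) (x : V) : affineEval (-γ) x = -affineEval γ x := by
  simp only [affineEval, Prod.fst_neg, Prod.snd_neg, inner_neg_left]
  ring

theorem affineEval_sub (γ γ' : V × ℝ) (x : V) :
    affineEval (γ - γ') x = affineEval γ x - affineEval γ' x := by
  rw [sub_eq_add_neg, affineEval_add, affineEval_neg, sub_eq_add_neg]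

theorem affineEval_smul (c : ℝ) (γ : V × ℝ) (x : V) :
    affineEval (c • γ) x = c * affineEval γ x := by
  simp only [affineEval, Prod.smul_fst, Prod.smul_snd, real_inner_smul_left, smul_eq_mul]
  ring

theorem affineEval_affineAction (w : V ≃ᵃⁱ[ℝ] V) (γ : V × ℝ) (x : V) :
    affineEval (affineAction w γ) (w x) = affineEval γ x :=
  affineAction_eval w γ x

theorem eq_of_affineEval_eq {γ γ' : V × ℝ} (h : ∀ x, affineEval γ x = affineEval γ' x) :
    γ = γ' := by
  have h0 : γ.2 = γ'.2 := by simpa [affineEval] using h 0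
  refine Prod.ext (ext_inner_right ℝ fun x => ?_) h0
  have := h x
  rwa [affineEval, affineEval, h0, add_left_inj] at this

theorem affineAction_mul (w w' : V ≃ᵃⁱ[ℝ] V) (γ : V × ℝ) :
    affineAction (w * w') γ = affineAction w (affineAction w' γ) := by
  refine eq_of_affineEval_eq fun x => ?_
  obtain ⟨y, rfl⟩ := (w * w').surjective x
  rw [affineEval_affineAction]
  change _ = affineEval (affineAction w (affineAction w' γ)) (w (w' y))
  rw [affineEval_affineAction, affineEval_affineAction]

theorem affineAction_one (γ : V × ℝ) : affineAction (1 : V ≃ᵃⁱ[ℝ] V) γ = γ := by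
  refine eq_of_affineEval_eq fun x => ?_
  exact affineEval_affineAction (1 : V ≃ᵃⁱ[ℝ] V) γ x

theorem affineAction_affineAction_inv (w : V ≃ᵃⁱ[ℝ] V) (γ : V × ℝ) :
    affineAction w (affineAction w⁻¹ γ) = γ := by
  rw [← affineAction_mul, mul_inv_cancel, affineAction_one]

theorem affineEval_affineAction_inv (w : V ≃ᵃⁱ[ℝ] V) (γ : V × ℝ) (x : V) :
    affineEval (affineAction w⁻¹ γ) x = affineEval γ (w x) := by
  rw [← affineEval_affineAction w, affineAction_affineAction_inv]

variable (R : EuclideanRootSystem V)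

/-- The affine roots `α + n δ`, with `α` a root and `n` an integer. -/
def affineRoots : Set (V × ℝ) := {γ | γ.1 ∈ R.roots ∧ ∃ n : ℤ, γ.2 = n}

/-- The elements `α + n δ`, with `α` a root or zero and `n` an integer. -/
def extendedRoots : Set (V × ℝ) := {γ | (γ.1 ∈ R.roots ∨ γ.1 = 0) ∧ ∃ n : ℤ, γ.2 = n}

variable {R}

theorem affineRoots_subset_extendedRoots : R.affineRoots ⊆ R.extendedRoots :=
  fun _ h => ⟨Or.inl h.1, h.2⟩

theorem neg_mem_affineRoots {γ : V × ℝ} (h : γ ∈ R.affineRoots) : -γ ∈ R.affineRoots := by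
  obtain ⟨h, n, hn⟩ := h
  exact ⟨R.neg_mem_roots h, -n, by simp [hn]⟩

theorem neg_mem_extendedRoots {γ : V × ℝ} (h : γ ∈ R.extendedRoots) : -γ ∈ R.extendedRoots := by
  obtain ⟨h, n, hn⟩ := h
  refine ⟨h.imp R.neg_mem_roots fun h => ?_, -n, by simp [hn]⟩
  simp [h]

/-- Multiples of δ are admitted for this: when the two gradients agree, the difference is such a
multiple. They also matter for indecomposability: in type A₁, α + δ is not a sum of two positive
affine roots, only of α and δ. -/
theorem sub_mem_extendedRoots {γ γ' : V × ℝ} (hγ : γ ∈ R.extendedRoots)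
    (hγ' : γ' ∈ R.affineRoots) (h : 0 < ⟪γ.1, γ'.1⟫_ℝ) : γ - γ' ∈ R.extendedRoots := by
  obtain ⟨h1, n, hn⟩ := hγ
  obtain ⟨h2, m, hm⟩ := hγ'
  refine ⟨?_, n - m, by simp [hn, hm]⟩
  rcases h1 with h1 | h1
  · by_cases hne : γ.1 = γ'.1
    · exact Or.inr (by simp [hne])
    · exact Or.inl (R.sub_mem_roots h1 h2 h hne)
  · simp [h1] at h

/-- The reflection in the affine root `α + n δ`. -/
def affineRefl (γ : V × ℝ) : V ≃ᵃⁱ[ℝ] V := affineReflection γ.1 (-⌊γ.2⌋)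

/-- The floor in `affineRefl` is exact on affine roots, and α + nδ vanishes on H_{α,-n}, whence the
sign. -/
theorem affineRefl_apply {γ : V × ℝ} (hγ : γ ∈ R.affineRoots) (x : V) :
    affineRefl γ x = x - affineEval γ x • coroot γ.1 := by
  obtain ⟨-, n, hn⟩ := hγ
  rw [affineRefl, affineReflection_apply, affineEval, hn, Int.floor_intCast, real_inner_comm]
  push_cast
  rw [sub_neg_eq_add]

theorem affineAction_affineRefl {γ : V × ℝ} (hγ : γ ∈ R.affineRoots) (γ' : V × ℝ) :
    affineAction (affineRefl γ) γ' = γ' - ⟪γ'.1, coroot γ.1⟫_ℝ • γ := by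
  obtain ⟨-, n, hn⟩ := hγ
  rw [affineRefl, hn, Int.floor_intCast, affineAction_affineReflection, ← hn]

theorem affineAction_affineRefl_add {γ : V × ℝ} (hγ : γ ∈ R.affineRoots) (x y : V × ℝ) :
    affineAction (affineRefl γ) (x + y) =
      affineAction (affineRefl γ) x + affineAction (affineRefl γ) y := by
  simp only [affineAction_affineRefl hγ, Prod.fst_add, inner_add_left]
  module

theorem inner_coroot_self {α : V} (hα : α ∈ R.roots) : ⟪α, coroot α⟫_ℝ = 2 := by
  rw [coroot, inner_smul_right, div_mul_cancel₀ _ (R.inner_self_pos hα).ne']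

theorem inner_coroot_pos_iff {α β : V} (hα : α ∈ R.roots) :
    0 < ⟪β, coroot α⟫_ℝ ↔ 0 < ⟪β, α⟫_ℝ := by
  rw [coroot, inner_smul_right]
  exact mul_pos_iff_of_pos_left (div_pos two_pos (R.inner_self_pos hα))

theorem affineAction_affineRefl_self {γ : V × ℝ} (hγ : γ ∈ R.affineRoots) :
    affineAction (affineRefl γ) γ = -γ := by
  rw [affineAction_affineRefl hγ, inner_coroot_self hγ.1]
  module

theorem affineRefl_mul_self {γ : V × ℝ} (hγ : γ ∈ R.affineRoots) :
    affineRefl γ * affineRefl γ = 1 := by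
  ext x
  change affineRefl γ (affineRefl γ x) = x
  have h := affineEval_affineAction (affineRefl γ) γ x
  rw [affineAction_affineRefl_self hγ, affineEval_neg, neg_eq_iff_eq_neg] at h
  rw [affineRefl_apply hγ (affineRefl γ x), h, affineRefl_apply hγ]
  module

theorem affineRefl_inv {γ : V × ℝ} (hγ : γ ∈ R.affineRoots) :
    (affineRefl γ)⁻¹ = affineRefl γ :=
  inv_eq_of_mul_eq_one_left (affineRefl_mul_self hγ)

theorem affineRefl_neg {γ : V × ℝ} (hγ : γ ∈ R.affineRoots) :
    affineRefl (-γ) = affineRefl γ := by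
  ext x
  rw [affineRefl_apply hγ, affineRefl_apply (neg_mem_affineRoots hγ), affineEval_neg]
  simp only [coroot, Prod.fst_neg, inner_neg_neg]
  module

theorem affineRefl_mem {γ : V × ℝ} (hγ : γ ∈ R.affineRoots) :
    affineRefl γ ∈ R.affineWeylGroup :=
  Subgroup.subset_closure ⟨γ.1, hγ.1, _, rfl⟩

theorem affineAction_affineRefl_mem_extendedRoots {γ γ' : V × ℝ} (hγ : γ ∈ R.affineRoots)
    (hγ' : γ' ∈ R.extendedRoots) : affineAction (affineRefl γ) γ' ∈ R.extendedRoots := by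
  rw [affineAction_affineRefl hγ]
  obtain ⟨h, m, hm⟩ := hγ
  obtain ⟨h1 | h1, n, hn⟩ := hγ'
  · obtain ⟨k, hk⟩ := R.exists_inner_coroot_eq h h1
    refine ⟨Or.inl (R.sub_inner_coroot_smul_mem_roots h h1), n - k * m, ?_⟩
    simp [hk, hm, hn]
  · exact ⟨Or.inr (by simp [h1]), n, by simp [h1, hn]⟩

theorem affineAction_affineRefl_mem_affineRoots {γ γ' : V × ℝ} (hγ : γ ∈ R.affineRoots)
    (hγ' : γ' ∈ R.affineRoots) : affineAction (affineRefl γ) γ' ∈ R.affineRoots := by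
  refine ⟨?_, (affineAction_affineRefl_mem_extendedRoots hγ
    (affineRoots_subset_extendedRoots hγ')).2⟩
  rw [affineAction_affineRefl hγ]
  exact R.sub_inner_coroot_smul_mem_roots hγ.1 hγ'.1

theorem affineReflection_eq_affineRefl (α : V) (k : ℤ) :
    affineReflection α k = affineRefl (α, ((-k : ℤ) : ℝ)) := by
  simp only [affineRefl, Int.floor_intCast, neg_neg]

theorem affineAction_mem_affineRoots_iff {w : V ≃ᵃⁱ[ℝ] V} (hw : w ∈ R.affineWeylGroup)
    {γ : V × ℝ} : affineAction w γ ∈ R.affineRoots ↔ γ ∈ R.affineRoots := by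
  induction hw using Subgroup.closure_induction generalizing γ with
  | mem s hs =>
    obtain ⟨α, hα, k, rfl⟩ := hs
    rw [affineReflection_eq_affineRefl]
    have h : (α, ((-k : ℤ) : ℝ)) ∈ R.affineRoots := ⟨hα, _, rfl⟩
    refine ⟨fun hγ => ?_, affineAction_affineRefl_mem_affineRoots h⟩
    have := affineAction_affineRefl_mem_affineRoots h hγ
    rwa [← affineAction_mul, affineRefl_mul_self h, affineAction_one] at this
  | one => rw [affineAction_one]
  | mul u v _ _ hu hv => rw [affineAction_mul, hu, hv]
  | inv u _ hu => rw [← hu, affineAction_affineAction_inv]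

/-- An isometry preserves the length of the gradient, so it carries coroots to coroots. This
identity replaces a reflection by a conjugate of smaller level, and moves reflections through words.
-/
theorem affineRefl_conj {γ γ' : V × ℝ} (hγ : γ ∈ R.affineRoots) (hγ' : γ' ∈ R.affineRoots) :
    affineRefl γ * affineRefl γ' * affineRefl γ = affineRefl (affineAction (affineRefl γ) γ') := by
  ext x
  have h0 := affineAction_affineRefl_mem_affineRoots hγ hγ'
  change affineRefl γ (affineRefl γ' (affineRefl γ x)) = _
  have h1 : affineEval γ' (affineRefl γ x) = affineEval (affineAction (affineRefl γ) γ') x := by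
    rw [← affineEval_affineAction_inv, affineRefl_inv hγ]
  have h2 : affineRefl γ (affineRefl γ x) = x := congrArg (· x) (affineRefl_mul_self hγ)
  have hinner : ∀ v : V, affineRefl γ (affineRefl γ x - v) =
      x - (v - ⟪γ.1, v⟫_ℝ • coroot γ.1) := by
    intro v
    conv_rhs => rw [← h2]
    rw [affineRefl_apply hγ (affineRefl γ x - v), affineRefl_apply hγ (affineRefl γ x)]
    have : affineEval γ (affineRefl γ x - v) = affineEval γ (affineRefl γ x) - ⟪γ.1, v⟫_ℝ := by
      simp only [affineEval, inner_sub_right]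
      ring
    rw [this]
    module
  rw [affineRefl_apply hγ', hinner, affineRefl_apply h0, h1]
  congr 1
  have h3 : (affineAction (affineRefl γ) γ').1 = γ'.1 - ⟪γ'.1, coroot γ.1⟫_ℝ • γ.1 := by
    rw [affineAction_affineRefl hγ]; rfl
  have h4 : ⟪(affineAction (affineRefl γ) γ').1, (affineAction (affineRefl γ) γ').1⟫_ℝ
      = ⟪γ'.1, γ'.1⟫_ℝ := by
    simp only [affineAction, LinearIsometryEquiv.inner_map_map]
  have h5 : coroot (affineAction (affineRefl γ) γ').1 =
      (2 / ⟪γ'.1, γ'.1⟫_ℝ) • (γ'.1 - ⟪γ'.1, coroot γ.1⟫_ℝ • γ.1) := by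
    rw [← h3, ← h4, coroot]
  rw [h5, coroot, coroot]
  simp only [inner_smul_right, smul_sub, smul_smul, real_inner_comm γ'.1 γ.1]
  module

end AffineRoots

/-! ### The affine Weyl group: simple reflections, exchange, inversion sets. -/

section AffineWeylGroup

variable {V : Type*} [NormedAddCommGroup V] [InnerProductSpace ℝ V] {R : EuclideanRootSystem V}

/-- On the fundamental alcove a positive root takes values in (0, 1), so the sign of α + nδ there is
decided by the integer n and the sign of α. Positivity thus becomes evaluation at a point. -/
theorem mem_affinePos_iff {x : V} (hx : x ∈ R.fundamentalAlcove) {γ : V × ℝ} :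
    γ ∈ R.affinePos ↔ γ ∈ R.affineRoots ∧ 0 < affineEval γ x := by
  constructor
  · rintro ⟨α, hα, n, rfl | rfl⟩
    · refine ⟨⟨hα.1, n, by simp⟩, ?_⟩
      have := (hx α hα).1
      rw [real_inner_comm] at this
      simp only [affineEval]
      positivity
    · refine ⟨⟨R.neg_mem_roots hα.1, n + 1, by simp⟩, ?_⟩
      have h1 := (hx α hα).2
      rw [real_inner_comm] at h1
      simp only [affineEval, inner_neg_left]
      have : (0 : ℝ) ≤ n := n.cast_nonneg
      linarith
  · rintro ⟨⟨hγ, n, hn⟩, h⟩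
    obtain ⟨v, c⟩ := γ
    simp only [affineEval] at hγ hn h
    subst hn
    rcases R.mem_pos_or_neg_mem_pos hγ with hp | hp
    · have h1 := (hx v hp).2
      rw [real_inner_comm] at h1
      have : (-1 : ℤ) < n := by
        have : (-1 : ℝ) < n := by linarith
        exact_mod_cast this
      obtain ⟨m, rfl⟩ := Int.eq_ofNat_of_zero_le (by omega : 0 ≤ n)
      exact ⟨v, hp, m, Or.inl (by simp)⟩
    · have h1 := (hx _ hp).1
      rw [real_inner_comm, inner_neg_left] at h1
      have : (0 : ℤ) < n := by
        have : (0 : ℝ) < n := by linarith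
        exact_mod_cast this
      obtain ⟨m, hm⟩ := Int.eq_ofNat_of_zero_le (by omega : 0 ≤ n - 1)
      refine ⟨-v, hp, m, Or.inr ?_⟩
      rw [neg_neg, sub_eq_iff_eq_add.1 hm]
      simp

theorem affineEval_ne_zero {x : V} (hx : x ∈ R.fundamentalAlcove) {γ : V × ℝ}
    (hγ : γ ∈ R.affineRoots) : affineEval γ x ≠ 0 := by
  have h : γ ∈ R.affinePos ∨ -γ ∈ R.affinePos := by
    obtain ⟨v, c⟩ := γ
    obtain ⟨hv, n, hn⟩ := hγ
    simp only at hv hn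
    subst hn
    rcases R.mem_pos_or_neg_mem_pos hv with hp | hp
    · rcases le_or_gt 0 n with h | h
      · obtain ⟨m, rfl⟩ := Int.eq_ofNat_of_zero_le h
        exact Or.inl ⟨v, hp, m, Or.inl (by simp)⟩
      · obtain ⟨m, hm⟩ := Int.eq_ofNat_of_zero_le (by omega : 0 ≤ -n - 1)
        refine Or.inr ⟨v, hp, m, Or.inr ?_⟩
        have : (m : ℝ) = -n - 1 := by exact_mod_cast hm.symm
        simp [this]
    · rcases le_or_gt n 0 with h | h
      · obtain ⟨m, hm⟩ := Int.eq_ofNat_of_zero_le (by omega : 0 ≤ -n)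
        refine Or.inr ⟨-v, hp, m, Or.inl ?_⟩
        have : (m : ℝ) = -n := by exact_mod_cast hm.symm
        simp [this]
      · obtain ⟨m, hm⟩ := Int.eq_ofNat_of_zero_le (by omega : 0 ≤ n - 1)
        refine Or.inl ⟨-v, hp, m, Or.inr ?_⟩
        have : (m : ℝ) = n - 1 := by exact_mod_cast hm.symm
        simp [this]
  rcases h with h | h
  · exact ((mem_affinePos_iff hx).1 h).2.ne'
  · have := ((mem_affinePos_iff hx).1 h).2
    rw [affineEval_neg] at this
    linarith

theorem affineEval_apply_ne_zero {w : V ≃ᵃⁱ[ℝ] V} (hw : w ∈ R.affineWeylGroup) {x : V}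
    (hx : x ∈ R.fundamentalAlcove) {γ : V × ℝ} (hγ : γ ∈ R.affineRoots) :
    affineEval γ (w x) ≠ 0 := by
  rw [← affineEval_affineAction_inv]
  exact affineEval_ne_zero hx ((affineAction_mem_affineRoots_iff (inv_mem hw)).2 hγ)

theorem affineRefl_mul_self_assoc {γ : V × ℝ} (hγ : γ ∈ R.affineRoots) (w : V ≃ᵃⁱ[ℝ] V) :
    affineRefl γ * (affineRefl γ * w) = w := by
  rw [← mul_assoc, affineRefl_mul_self hγ, one_mul]

variable (R)

/-- The point is the height vector divided by M + 1, where M bounds the heights of the positive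
roots: positive roots then take values in (0, 1) with common denominator M + 1. The integrality
makes induction on values possible. -/
theorem exists_basePoint [FiniteDimensional ℝ V] : ∃ x ∈ R.fundamentalAlcove, ∃ M : ℕ, 0 < M ∧
    ∀ γ ∈ R.extendedRoots, ∃ n : ℤ, M * affineEval γ x = n := by
  obtain ⟨M, hM⟩ := (R.finite_pos.image R.height).bddAbove
  have hlt : ∀ α ∈ R.pos, R.height α < M + 1 := fun α hα =>
    Nat.lt_succ_of_le (hM (Set.mem_image_of_mem _ hα))
  have hM0 : (0 : ℝ) < (M + 1 : ℕ) := by positivity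
  refine ⟨((M + 1 : ℕ) : ℝ)⁻¹ • R.heightVector, fun α hα => ?_, M + 1, by omega, ?_⟩
  · rw [real_inner_smul_left, R.inner_heightVector_eq_height hα.2, inv_mul_eq_div, div_lt_one hM0]
    have h1 : (0 : ℝ) < R.height α := by exact_mod_cast R.height_pos hα
    exact ⟨by positivity, by exact_mod_cast hlt α hα⟩
  · rintro ⟨v, c⟩ ⟨hv, n, rfl⟩
    have hint : ∃ k : ℤ, ⟪R.heightVector, v⟫_ℝ = k := by
      rcases hv with hv | hv
      · rcases R.mem_or_neg_mem v hv with h | h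
        · exact ⟨R.height v, by rw [R.inner_heightVector_eq_height h]; simp⟩
        · refine ⟨-R.height (-v), ?_⟩
          have := R.inner_heightVector_eq_height h
          rw [inner_neg_right] at this
          push_cast
          linarith
      · exact ⟨0, by simp only at hv; simp [hv]⟩
    obtain ⟨k, hk⟩ := hint
    refine ⟨k + (M + 1) * n, ?_⟩
    rw [affineEval, inner_smul_right, real_inner_comm, hk, mul_add, mul_inv_cancel_left₀ hM0.ne']
    push_cast
    ring

variable [FiniteDimensional ℝ V]

/-- A point of the fundamental alcove on which all affine roots take values with a common
denominator. -/
def basePoint : V := R.exists_basePoint.choose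

theorem basePoint_mem : R.basePoint ∈ R.fundamentalAlcove := R.exists_basePoint.choose_spec.1

/-- The multiple of the value at the base point which is an integer on all affine roots. -/
def level (γ : V × ℝ) : ℕ :=
  ⌊(R.exists_basePoint.choose_spec.2.choose : ℝ) * affineEval γ R.basePoint⌋.toNat

variable {R}

/-- The floor is exact by the choice of the base point, and positivity of the smaller value keeps
the truncation to ℕ harmless. -/
theorem level_lt_level {γ γ' : V × ℝ} (hγ : γ ∈ R.extendedRoots) (hγ' : γ' ∈ R.extendedRoots)
    (h0 : 0 < affineEval γ R.basePoint)
    (h : affineEval γ R.basePoint < affineEval γ' R.basePoint) : R.level γ < R.level γ' := by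
  obtain ⟨hM, hint⟩ := R.exists_basePoint.choose_spec.2.choose_spec
  obtain ⟨n, hn⟩ := hint γ hγ
  obtain ⟨m, hm⟩ := hint γ' hγ'
  have hM' : (0 : ℝ) < R.exists_basePoint.choose_spec.2.choose := by exact_mod_cast hM
  rw [level, level, basePoint, hn, hm]
  have h1 : (n : ℝ) < m := by rw [← hn, ← hm]; exact mul_lt_mul_of_pos_left h hM'
  have h2 : (0 : ℝ) < n := by rw [← hn]; exact mul_pos hM' h0
  have h1' : n < m := by exact_mod_cast h1
  have h2' : 0 < n := by exact_mod_cast h2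
  rw [Int.floor_intCast, Int.floor_intCast]
  omega

theorem mem_affinePos_iff_basePoint {γ : V × ℝ} :
    γ ∈ R.affinePos ↔ γ ∈ R.affineRoots ∧ 0 < affineEval γ R.basePoint :=
  mem_affinePos_iff R.basePoint_mem

theorem mem_affinePos_or_neg_mem {γ : V × ℝ} (hγ : γ ∈ R.affineRoots) :
    γ ∈ R.affinePos ∨ -γ ∈ R.affinePos := by
  rw [mem_affinePos_iff_basePoint, mem_affinePos_iff_basePoint, affineEval_neg]
  rcases lt_or_gt_of_ne (affineEval_ne_zero R.basePoint_mem hγ) with h | h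
  · exact Or.inr ⟨neg_mem_affineRoots hγ, by linarith⟩
  · exact Or.inl ⟨hγ, h⟩

variable (R) in
/-- The positive elements of the extended affine root system, including the positive multiples
of `δ`. -/
def extendedPos : Set (V × ℝ) := {γ ∈ R.extendedRoots | 0 < affineEval γ R.basePoint}

theorem affineRoots_of_mem_affinePos {γ : V × ℝ} (h : γ ∈ R.affinePos) : γ ∈ R.affineRoots :=
  (mem_affinePos_iff_basePoint.1 h).1

theorem affinePos_subset_extendedPos : R.affinePos ⊆ R.extendedPos := fun _ h =>
  ⟨affineRoots_subset_extendedRoots (affineRoots_of_mem_affinePos h),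
    (mem_affinePos_iff_basePoint.1 h).2⟩

theorem mem_extendedPos_or_neg_mem {γ : V × ℝ} (hγ : γ ∈ R.extendedRoots) (h0 : γ ≠ 0) :
    γ ∈ R.extendedPos ∨ -γ ∈ R.extendedPos := by
  have hne : affineEval γ R.basePoint ≠ 0 := by
    rcases hγ with ⟨h | h, h'⟩
    · exact affineEval_ne_zero R.basePoint_mem ⟨h, h'⟩
    · intro h1
      refine h0 (Prod.ext h ?_)
      simpa [affineEval, h] using h1
  rcases lt_or_gt_of_ne hne with h | h
  · exact Or.inr ⟨neg_mem_extendedRoots hγ, by rw [affineEval_neg]; linarith⟩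
  · exact Or.inl ⟨hγ, h⟩

variable (R) in
/-- The simple affine roots: the positive affine roots which are not sums of two positive
elements of the extended affine root system. -/
def affineSimple : Set (V × ℝ) :=
  {α ∈ R.affinePos | ∀ x ∈ R.extendedPos, ∀ y ∈ R.extendedPos, x + y ≠ α}

/-- Descent on the level: a decomposable element of S has a summand in S, and this summand has
smaller level because the other one is positive. -/
theorem exists_indecomposable {S : Set (V × ℝ)} (hS : S ⊆ R.extendedPos) (hne : S.Nonempty)
    (h : ∀ x ∈ R.extendedPos, ∀ y ∈ R.extendedPos, x + y ∈ S → x ∈ S ∨ y ∈ S) :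
    ∃ α ∈ S, ∀ x ∈ R.extendedPos, ∀ y ∈ R.extendedPos, x + y ≠ α := by
  obtain ⟨γ, hγ⟩ := hne
  induction hn : R.level γ using Nat.strong_induction_on generalizing γ with
  | _ n ih =>
    by_cases hind : ∀ x ∈ R.extendedPos, ∀ y ∈ R.extendedPos, x + y ≠ γ
    · exact ⟨γ, hγ, hind⟩
    push Not at hind
    obtain ⟨x, hx, y, hy, rfl⟩ := hind
    have hxy := hS hγ
    rcases h x hx y hy hγ with h' | h'
    · refine ih _ ?_ x h' rfl
      rw [← hn]
      refine level_lt_level hx.1 hxy.1 hx.2 ?_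
      have := hy.2
      rw [affineEval_add]
      linarith
    · refine ih _ ?_ y h' rfl
      rw [← hn]
      refine level_lt_level hy.1 hxy.1 hy.2 ?_
      have := hx.2
      rw [affineEval_add]
      linarith

/-- Induction on a bound for n = ⟨β, α^∨⟩. If n ≤ 0, then sβ = β - nα is visibly positive. If n > 0,
then β - α is positive, as otherwise α = β + (α - β) would decompose; its pairing is n - 2, so s(β -
α) = sβ + α is positive by induction. Were sβ negative, α = -sβ + (sβ + α) would decompose. -/
theorem affineRefl_affineSimple_mem_extendedPos {α β : V × ℝ} (hα : α ∈ R.affineSimple)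
    (hβ : β ∈ R.extendedPos) (hne : β ≠ α) :
    affineAction (affineRefl α) β ∈ R.extendedPos := by
  have hαr := affineRoots_of_mem_affinePos hα.1
  have hαe := affinePos_subset_extendedPos hα.1
  have hint : ∃ n : ℤ, ⟪β.1, coroot α.1⟫_ℝ = n := by
    rcases hβ.1.1 with h | h
    · exact R.exists_inner_coroot_eq hαr.1 h
    · exact ⟨0, by simp [h]⟩
  obtain ⟨n, hn⟩ := hint
  obtain ⟨N, hN⟩ : ∃ N : ℕ, n.toNat ≤ N := ⟨_, le_rfl⟩
  induction N generalizing β n with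
  | zero =>
    refine ⟨affineAction_affineRefl_mem_extendedRoots hαr hβ.1, ?_⟩
    rw [affineAction_affineRefl hαr, affineEval_sub, affineEval_smul, hn]
    have h0 : (n : ℝ) ≤ 0 := by exact_mod_cast (by omega : n ≤ 0)
    have := hβ.2
    have := hαe.2
    nlinarith
  | succ N ih =>
    have hsr := affineAction_affineRefl_mem_extendedRoots hαr hβ.1
    by_cases hn0 : n ≤ 0
    · exact ih hβ hne n hn (by omega)
    have hn0' : (0 : ℝ) < n := by exact_mod_cast (by omega : 0 < n)
    have hpos : 0 < ⟪β.1, α.1⟫_ℝ := (inner_coroot_pos_iff hαr.1).1 (by rw [hn]; exact hn0')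
    have hsub := sub_mem_extendedRoots hβ.1 hαr hpos
    rcases mem_extendedPos_or_neg_mem hsub (sub_ne_zero.2 hne) with h | h
    swap
    · exact absurd (by rw [neg_sub]; abel) (hα.2 β hβ _ h)
    -- Otherwise β has gradient 2α, which is not a root in a reduced system.
    have hne' : β - α ≠ α := by
      intro he
      have he' : β.1 = (2 : ℝ) • α.1 := by
        have := congrArg Prod.fst (sub_eq_iff_eq_add.1 he)
        rw [this, Prod.fst_add, two_smul]
      rcases hβ.1.1 with h1 | h1
      · rw [he'] at h1
        rcases R.reduced _ hαr.1 _ h1 with h2 | h2 <;> norm_num at h2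
      · simp [h1] at hpos
    have hs := ih h hne' (n - 2)
      (by rw [Prod.fst_sub, inner_sub_left, inner_coroot_self hαr.1, hn]; push_cast; rfl) (by omega)
    have hs' : affineAction (affineRefl α) (β - α) = affineAction (affineRefl α) β + α := by
      have := affineAction_affineRefl_add hαr (β - α) α
      rw [sub_add_cancel, affineAction_affineRefl_self hαr] at this
      rw [this]
      abel
    rw [hs'] at hs
    have h0 : affineAction (affineRefl α) β ≠ 0 := by
      intro h0
      have h2 := congrArg (affineAction (affineRefl α)) h0
      rw [← affineAction_mul, affineRefl_mul_self hαr, affineAction_one,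
        affineAction_affineRefl hαr] at h2
      simp only [Prod.fst_zero, inner_zero_left, zero_smul, sub_zero] at h2
      simp [h2] at hpos
    rcases mem_extendedPos_or_neg_mem hsr h0 with h1 | h1
    · exact h1
    · exact absurd (by abel) (hα.2 _ h1 _ hs)

theorem affineRefl_affineSimple_mem_affinePos {α β : V × ℝ} (hα : α ∈ R.affineSimple)
    (hβ : β ∈ R.affinePos) (hne : β ≠ α) : affineAction (affineRefl α) β ∈ R.affinePos := by
  rw [mem_affinePos_iff_basePoint]
  exact ⟨affineAction_affineRefl_mem_affineRoots (affineRoots_of_mem_affinePos hα.1)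
    (affineRoots_of_mem_affinePos hβ), (affineRefl_affineSimple_mem_extendedPos hα
      (affinePos_subset_extendedPos hβ) hne).2⟩

variable (R) in
/-- `IsSimpleWord k w`: the affine isometry `w` is a product of `k` simple reflections. -/
inductive IsSimpleWord : ℕ → (V ≃ᵃⁱ[ℝ] V) → Prop
  | one : IsSimpleWord 0 1
  | mul {k : ℕ} {α : V × ℝ} {w : V ≃ᵃⁱ[ℝ] V} (hα : α ∈ R.affineSimple) (hw : IsSimpleWord k w) :
      IsSimpleWord (k + 1) (affineRefl α * w)

theorem exists_affineSimple_inner_pos {γ : V × ℝ} (hγ : γ ∈ R.affinePos) :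
    ∃ α ∈ R.affineSimple, 0 < ⟪γ.1, α.1⟫_ℝ := by
  have hγr := affineRoots_of_mem_affinePos hγ
  -- Since ⟨γ, ·⟩ is additive, one summand of an element of this set stays in it; γ itself belongs
  -- to it, and multiples of δ do not.
  obtain ⟨α, hα, hind⟩ := exists_indecomposable (R := R)
    (S := {β ∈ R.extendedPos | 0 < ⟪γ.1, β.1⟫_ℝ}) (fun _ h => h.1)
    ⟨γ, affinePos_subset_extendedPos hγ, R.inner_self_pos hγr.1⟩
    (fun x hx y hy hxy => by
      have := hxy.2
      rw [Prod.fst_add, inner_add_right] at this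
      by_contra! hc
      have h1 : ¬ 0 < ⟪γ.1, x.1⟫_ℝ := fun h => hc.1 ⟨hx, h⟩
      have h2 : ¬ 0 < ⟪γ.1, y.1⟫_ℝ := fun h => hc.2 ⟨hy, h⟩
      linarith)
  refine ⟨α, ⟨mem_affinePos_iff_basePoint.2 ⟨⟨?_, hα.1.1.2⟩, hα.1.2⟩, hind⟩, hα.2⟩
  rcases hα.1.1.1 with h | h
  · exact h
  · have := hα.2
    simp [h] at this

/-- Induction on the level of γ: for α simple with ⟨γ, α⟩ > 0, the root s_α γ is γ minus a positive
multiple of α, and s_γ = s_α s_{s_α γ} s_α. -/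
theorem IsSimpleWord.exists_affineRefl_mul {γ : V × ℝ} (hγ : γ ∈ R.affinePos) {k : ℕ}
    {w : V ≃ᵃⁱ[ℝ] V} (hw : R.IsSimpleWord k w) : ∃ k', R.IsSimpleWord k' (affineRefl γ * w) := by
  induction hn : R.level γ using Nat.strong_induction_on generalizing γ k w with
  | _ n ih =>
    obtain ⟨α, hα, hin⟩ := exists_affineSimple_inner_pos hγ
    rcases eq_or_ne γ α with rfl | hne
    · exact ⟨_, .mul hα hw⟩
    have hαr := affineRoots_of_mem_affinePos hα.1
    have hγr := affineRoots_of_mem_affinePos hγ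
    have hγ' := affineRefl_affineSimple_mem_affinePos hα hγ hne
    have hlt : R.level (affineAction (affineRefl α) γ) < n := by
      rw [← hn]
      refine level_lt_level (affinePos_subset_extendedPos hγ').1
        (affinePos_subset_extendedPos hγ).1 (affinePos_subset_extendedPos hγ').2 ?_
      rw [affineAction_affineRefl hαr, affineEval_sub, affineEval_smul]
      have h1 := (inner_coroot_pos_iff hαr.1).2 hin
      have h2 := (affinePos_subset_extendedPos hα.1).2
      have := mul_pos h1 h2
      linarith
    obtain ⟨k', hk'⟩ := ih _ hlt hγ' (.mul hα hw) rfl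
    refine ⟨k' + 1, ?_⟩
    have := hk'.mul hα
    simpa only [← affineRefl_conj hαr hγr, mul_assoc, affineRefl_mul_self_assoc hαr] using this

theorem exists_isSimpleWord {w : V ≃ᵃⁱ[ℝ] V} (hw : w ∈ R.affineWeylGroup) :
    ∃ k, R.IsSimpleWord k w := by
  have key : ∀ α ∈ R.roots, ∀ n : ℤ, ∀ w k, R.IsSimpleWord k w →
      ∃ k', R.IsSimpleWord k' (affineReflection α n * w) := by
    intro α hα n w k hk
    rw [affineReflection_eq_affineRefl]
    have h : (α, ((-n : ℤ) : ℝ)) ∈ R.affineRoots := ⟨hα, _, rfl⟩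
    rcases mem_affinePos_or_neg_mem h with hp | hp
    · exact hk.exists_affineRefl_mul hp
    · rw [← affineRefl_neg h]
      exact hk.exists_affineRefl_mul hp
  induction hw using Subgroup.closure_induction_left with
  | one => exact ⟨0, .one⟩
  | mul_left s hs w _ ih =>
    obtain ⟨α, hα, n, rfl⟩ := hs
    obtain ⟨k, hk⟩ := ih
    exact key α hα n w k hk
  | inv_mul_cancel s hs w _ ih =>
    obtain ⟨α, hα, n, rfl⟩ := hs
    obtain ⟨k, hk⟩ := ih
    have h : (α, ((-n : ℤ) : ℝ)) ∈ R.affineRoots := ⟨hα, _, rfl⟩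
    rw [affineReflection_eq_affineRefl, affineRefl_inv h, ← affineReflection_eq_affineRefl]
    exact key α hα n w k hk

/-- The strong exchange property. -/
theorem IsSimpleWord.exchange {k : ℕ} {w : V ≃ᵃⁱ[ℝ] V} (hw : R.IsSimpleWord k w) {γ : V × ℝ}
    (hγ : γ ∈ R.affinePos) (hneg : affineEval γ (w R.basePoint) < 0) :
    ∃ k', k = k' + 1 ∧ R.IsSimpleWord k' (affineRefl γ * w) := by
  induction hw generalizing γ with
  | one => exact absurd (mem_affinePos_iff_basePoint.1 hγ).2 hneg.not_gt
  | @mul k α w hα hw ih =>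
    have hαr := affineRoots_of_mem_affinePos hα.1
    have hγr := affineRoots_of_mem_affinePos hγ
    -- If γ is the first letter, s_γ deletes it. Otherwise s_α γ is still positive and is negative
    -- at the image of the base point under the rest of the word.
    rcases eq_or_ne γ α with rfl | hne
    · exact ⟨k, rfl, by rwa [← mul_assoc, affineRefl_mul_self hαr, one_mul]⟩
    have h : affineEval γ (affineRefl α (w R.basePoint)) < 0 := hneg
    rw [← affineEval_affineAction_inv, affineRefl_inv hαr] at h
    obtain ⟨k', rfl, hk'⟩ := ih (affineRefl_affineSimple_mem_affinePos hα hγ hne) h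
    refine ⟨k' + 1, rfl, ?_⟩
    have := hk'.mul hα
    simpa only [← affineRefl_conj hαr hγr, mul_assoc, affineRefl_mul_self_assoc hαr] using this

/-- If the word starts with s_α, then α is negative at the image of the base point under the
remaining word, so exchange rewrites the product as a shorter word; descend. -/
theorem eq_one_of_forall_affineEval_pos {w : V ≃ᵃⁱ[ℝ] V} (hw : w ∈ R.affineWeylGroup)
    (h : ∀ γ ∈ R.affinePos, 0 < affineEval γ (w R.basePoint)) : w = 1 := by
  obtain ⟨k, hk⟩ := exists_isSimpleWord hw
  induction k using Nat.strong_induction_on with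
  | _ k ih =>
    cases hk with
    | one => rfl
    | @mul k α w hα hw' =>
      have hαr := affineRoots_of_mem_affinePos hα.1
      have h1 : 0 < affineEval α (affineRefl α (w R.basePoint)) := h α hα.1
      rw [← affineEval_affineAction_inv, affineRefl_inv hαr, affineAction_affineRefl_self hαr,
        affineEval_neg] at h1
      obtain ⟨k', rfl, hk'⟩ := hw'.exchange hα.1 (by linarith)
      exact ih k' (by omega) hk'

/-- Inversions are the positive affine roots whose hyperplanes separate the alcove of w from the
fundamental one; any point of the latter can serve as a test point. -/
theorem mem_inversionSet_iff {x : V} (hx : x ∈ R.fundamentalAlcove) {w : R.affineWeylGroup}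
    {γ : V × ℝ} : γ ∈ R.inversionSet w ↔
      γ ∈ R.affinePos ∧ affineEval γ ((w : V ≃ᵃⁱ[ℝ] V) x) < 0 := by
  rw [inversionSet, Set.mem_inter_iff, and_congr_right_iff]
  intro hγ
  constructor
  · rintro ⟨γ', hγ', rfl⟩
    have := ((mem_affinePos_iff hx).1 hγ').2
    rw [affineEval_neg] at this
    rw [affineEval_affineAction]
    linarith
  · intro h
    refine ⟨affineAction (w : V ≃ᵃⁱ[ℝ] V)⁻¹ γ, ?_, affineAction_affineAction_inv _ _⟩
    rw [Set.mem_ofPred_eq, mem_affinePos_iff hx, affineEval_neg, affineEval_affineAction_inv]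
    exact ⟨neg_mem_affineRoots ((affineAction_mem_affineRoots_iff (inv_mem w.2)).2
      (affineRoots_of_mem_affinePos hγ)), by linarith⟩

/-- The inversion set determines the sign of every affine root at the image of the base point, so
w⁻¹w' leaves all positive affine roots positive at the base point. -/
theorem inversionSet_injective : Function.Injective R.inversionSet := by
  intro w w' hww'
  have hx := R.basePoint_mem
  suffices h : (w : V ≃ᵃⁱ[ℝ] V)⁻¹ * w' = 1 from Subtype.ext (inv_mul_eq_one.1 h)
  refine eq_one_of_forall_affineEval_pos (mul_mem (inv_mem w.2) w'.2) fun γ hγ => ?_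
  change 0 < affineEval γ ((w : V ≃ᵃⁱ[ℝ] V)⁻¹ ((w' : V ≃ᵃⁱ[ℝ] V) R.basePoint))
  rw [← affineEval_affineAction_inv, inv_inv]
  have h1 := affineEval_affineAction (w : V ≃ᵃⁱ[ℝ] V) γ R.basePoint
  have h2 := (mem_affinePos_iff_basePoint.1 hγ).2
  rw [← h1] at h2
  have hr : affineAction (w : V ≃ᵃⁱ[ℝ] V) γ ∈ R.affineRoots :=
    (affineAction_mem_affineRoots_iff w.2).2 (affineRoots_of_mem_affinePos hγ)
  set β := affineAction (w : V ≃ᵃⁱ[ℝ] V) γ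
  rcases mem_affinePos_or_neg_mem hr with hp | hp
  · have h3 : β ∉ R.inversionSet w' := by
      rw [← hww', mem_inversionSet_iff hx]
      exact fun h => h.2.not_gt h2
    rw [mem_inversionSet_iff hx, not_and, not_lt] at h3
    exact (h3 hp).lt_of_ne (affineEval_apply_ne_zero w'.2 hx hr).symm
  · have h3 : -β ∈ R.inversionSet w' := by
      rw [← hww', mem_inversionSet_iff hx, affineEval_neg]
      exact ⟨hp, by linarith⟩
    rw [mem_inversionSet_iff hx, affineEval_neg] at h3
    linarith [h3.2]

/-- A finite set of positive affine roots which is closed and coclosed is an inversion set. -/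
theorem exists_inversionSet_eq {N : Set (V × ℝ)} (hfin : N.Finite) (hpos : N ⊆ R.affinePos)
    (hclosed : ∀ x ∈ N, ∀ y ∈ N, x + y ∈ R.extendedRoots → x + y ∈ N)
    (hcoclosed : ∀ x ∈ R.extendedPos, ∀ y ∈ R.extendedPos, x + y ∈ N → x ∈ N ∨ y ∈ N) :
    ∃ w : R.affineWeylGroup, R.inversionSet w = N := by
  have hx := R.basePoint_mem
  induction hn : N.ncard using Nat.strong_induction_on generalizing N with
  | _ n ih =>
  rcases N.eq_empty_or_nonempty with rfl | hne
  · refine ⟨1, ?_⟩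
    ext γ
    rw [mem_inversionSet_iff hx]
    simp only [Set.mem_empty_iff_false, iff_false, not_and, not_lt]
    exact fun h => (mem_affinePos_iff_basePoint.1 h).2.le
  -- Coclosedness supplies an element of N that is indecomposable among all positive elements, that
  -- is, a simple affine root.
  obtain ⟨α, hαN, hind⟩ := exists_indecomposable (hpos.trans affinePos_subset_extendedPos) hne
    hcoclosed
  have hα : α ∈ R.affineSimple := ⟨hpos hαN, hind⟩
  have hαr := affineRoots_of_mem_affinePos hα.1
  have hss : ∀ γ, affineAction (affineRefl α) (affineAction (affineRefl α) γ) = γ := fun γ => by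
    rw [← affineAction_mul, affineRefl_mul_self hαr, affineAction_one]
  have hadd := affineAction_affineRefl_add hαr
  have hself := affineAction_affineRefl_self hαr
  have hneg : affineAction (affineRefl α) (-α) = α := by rw [← hself, hss]
  have hmem : ∀ γ ∈ R.extendedRoots, affineAction (affineRefl α) γ ∈ R.extendedRoots :=
    fun γ => affineAction_affineRefl_mem_extendedRoots hαr
  have hnegα : -α ∉ R.extendedPos := fun h => by
    have h1 := h.2
    have h2 := (affinePos_subset_extendedPos hα.1).2
    rw [affineEval_neg] at h1
    linarith
  have hNe : N ⊆ R.extendedPos := hpos.trans affinePos_subset_extendedPos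
  let s := affineAction (affineRefl α)
  -- This is s(N \ {α}), written as a preimage because s is an involution.
  let N' : Set (V × ℝ) := {γ | s γ ∈ N ∧ s γ ≠ α}
  have hN' : N' = s '' (N \ {α}) := by
    ext γ
    constructor
    · exact fun h => ⟨s γ, ⟨h.1, h.2⟩, hss γ⟩
    · rintro ⟨γ', h, rfl⟩
      exact ⟨by rw [show s (s γ') = γ' from hss γ']; exact h.1,
        by rw [show s (s γ') = γ' from hss γ']; exact h.2⟩
  have hcard : N'.ncard < n := by
    rw [hN', ← hn]
    exact (Set.ncard_image_le hfin.sdiff).trans_lt (Set.ncard_sdiff_singleton_lt_of_mem hαN hfin)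
  have hpos' : N' ⊆ R.affinePos := by
    rw [hN']
    rintro _ ⟨γ, h, rfl⟩
    exact affineRefl_affineSimple_mem_affinePos hα (hpos h.1) h.2
  have hclosed' : ∀ x ∈ N', ∀ y ∈ N', x + y ∈ R.extendedRoots → x + y ∈ N' := by
    intro x hx y hy hxy
    have h : s (x + y) = s x + s y := hadd x y
    refine ⟨?_, ?_⟩
    · rw [h]
      exact hclosed _ hx.1 _ hy.1 (by rw [← h]; exact hmem _ hxy)
    · rw [h]
      exact hind _ (hNe hx.1) _ (hNe hy.1)
  -- The summand α needs separate care, since s makes it negative. Here s y = s(α + y) + α is a sum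
  -- of two elements of N, so closedness applies.
  have haux : ∀ y ∈ R.extendedPos, α + y ∈ N' → y ∈ N' := by
    intro y hy hxy
    have h : s (α + y) = -α + s y := by rw [← hself]; exact hadd α y
    have h1 : s (α + y) + α = s y := by rw [h]; abel
    refine ⟨?_, fun h2 => ?_⟩
    · rw [← h1]
      exact hclosed _ hxy.1 _ hαN (by rw [h1]; exact hmem _ hy.1)
    · have : y = -α := by rw [← hss y, show affineAction (affineRefl α) y = α from h2, hself]
      exact hnegα (this ▸ hy)
  have hcoclosed' : ∀ x ∈ R.extendedPos, ∀ y ∈ R.extendedPos, x + y ∈ N' → x ∈ N' ∨ y ∈ N' := by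
    intro x hx y hy hxy
    rcases eq_or_ne x α with rfl | hxα
    · exact Or.inr (haux y hy hxy)
    rcases eq_or_ne y α with rfl | hyα
    · exact Or.inl (haux x hx (by rwa [add_comm]))
    have hsα : ∀ z ∈ R.extendedPos, s z ≠ α := by
      intro z hz hzα
      have : z = -α := by rw [← hss z, show affineAction (affineRefl α) z = α from hzα, hself]
      exact hnegα (this ▸ hz)
    have h1 := hxy.1
    rw [show s (x + y) = s x + s y from hadd x y] at h1
    exact (hcoclosed _ (affineRefl_affineSimple_mem_extendedPos hα hx hxα) _
      (affineRefl_affineSimple_mem_extendedPos hα hy hyα) h1).imp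
      (fun h => ⟨h, hsα x hx⟩) (fun h => ⟨h, hsα y hy⟩)
  obtain ⟨w, hw⟩ := ih _ hcard (hN' ▸ (hfin.sdiff).image s) hpos' hclosed' hcoclosed' rfl
  refine ⟨⟨affineRefl α, affineRefl_mem hαr⟩ * w, ?_⟩
  ext γ
  rw [mem_inversionSet_iff hx]
  change γ ∈ R.affinePos ∧ affineEval γ (affineRefl α ((w : V ≃ᵃⁱ[ℝ] V) R.basePoint)) < 0 ↔ _
  rw [← affineEval_affineAction_inv, affineRefl_inv hαr]
  have hiff : ∀ γ', γ' ∈ N' ↔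
      γ' ∈ R.affinePos ∧ affineEval γ' ((w : V ≃ᵃⁱ[ℝ] V) R.basePoint) < 0 := fun γ' => by
    rw [← hw, mem_inversionSet_iff hx]
  rcases eq_or_ne γ α with rfl | hγα
  -- As α ∉ N' = N(w), α is positive on the alcove of w, hence negative after applying s.
  · rw [hself, affineEval_neg]
    have h1 : γ ∉ N' := fun h => hnegα (hself ▸ hNe h.1)
    rw [hiff, not_and, not_lt] at h1
    have h2 := affineEval_apply_ne_zero w.2 hx hαr
    exact ⟨fun _ => hαN, fun _ => ⟨hα.1, neg_neg_of_pos ((h1 hα.1).lt_of_ne h2.symm)⟩⟩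
  · constructor
    · rintro ⟨h1, h2⟩
      have h3 := (hiff _).2 ⟨affineRefl_affineSimple_mem_affinePos hα h1 hγα, h2⟩
      have h4 := h3.1
      rwa [show s (affineAction (affineRefl α) γ) = γ from hss γ] at h4
    · intro h
      refine ⟨hpos h, ((hiff _).1 ⟨?_, ?_⟩).2⟩
      · rwa [show s (affineAction (affineRefl α) γ) = γ from hss γ]
      · rwa [show s (affineAction (affineRefl α) γ) = γ from hss γ]

end AffineWeylGroup

/-! ### Root ideals, their powers, and the set 𝕃_Ψ. -/

section RootIdeals

variable {V : Type*} [NormedAddCommGroup V] [InnerProductSpace ℝ V]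

/-- A set of positive roots which is closed under the addition of positive roots. -/
structure IsRootIdeal (R : EuclideanRootSystem V) (Ψ : Set V) : Prop where
  subset_pos : Ψ ⊆ R.pos
  add_mem : ∀ α ∈ Ψ, ∀ β ∈ R.pos, α + β ∈ R.roots → α + β ∈ Ψ

variable {R : EuclideanRootSystem V} [FiniteDimensional ℝ V] {Ψ : Set V}

namespace IsRootIdeal

theorem bracketPow (h : R.IsRootIdeal Ψ) (n : ℕ) : R.IsRootIdeal (R.bracketPow Ψ n) := by
  induction n with
  | zero => exact h
  | succ n ih =>
    refine ⟨fun _ hγ => hγ.1, ?_⟩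
    rintro _ ⟨hγ, a, ha, b, hb, rfl⟩ β hβ hr
    have hap := ih.subset_pos ha
    have hbp := h.subset_pos hb
    rcases R.add_mem_roots_or_add_mem_roots hap.1 hbp.1 hβ.1 hγ.1 hr
      (R.add_ne_zero_of_mem_pos hap hβ.2) (R.add_ne_zero_of_mem_pos hbp hβ.2) with h1 | h1
    · exact ⟨R.add_mem_pos hγ hβ hr, a + β, ih.add_mem a ha β hβ h1, b, hb, by abel⟩
    · exact ⟨R.add_mem_pos hγ hβ hr, a, ha, b + β, h.add_mem b hb β hβ h1, by abel⟩

theorem bracketPow_antitone (h : R.IsRootIdeal Ψ) : Antitone (R.bracketPow Ψ) := by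
  refine antitone_nat_of_succ_le fun n => ?_
  rintro _ ⟨hγ, a, ha, b, hb, rfl⟩
  exact (h.bracketPow n).add_mem a ha b (h.subset_pos hb) hγ.1

/-- With the shifted index, the exponents (n + 1) and (m + 1) add up to n + m + 2. Writing b = c + d
with d ∈ Ψ, one of a + c and a + d is a root: in the first case d is added last, in the second a + d
gains one power and c is added to it. -/
theorem add_mem_bracketPow (h : R.IsRootIdeal Ψ) {n m : ℕ} {a b : V}
    (ha : a ∈ R.bracketPow Ψ n) (hb : b ∈ R.bracketPow Ψ m) (hab : a + b ∈ R.roots) :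
    a + b ∈ R.bracketPow Ψ (n + m + 1) := by
  induction m generalizing n a b with
  | zero =>
    exact ⟨R.add_mem_pos ((h.bracketPow n).subset_pos ha) (h.subset_pos hb) hab, a, ha, b, hb, rfl⟩
  | succ m ih =>
    obtain ⟨hb', c, hc, d, hd, rfl⟩ := hb
    have hap := (h.bracketPow n).subset_pos ha
    have hcp := (h.bracketPow m).subset_pos hc
    have hdp := h.subset_pos hd
    have hab' := R.add_mem_pos hap hb' hab
    rcases R.add_mem_roots_or_add_mem_roots hcp.1 hdp.1 hap.1 hb'.1
      (by rwa [add_comm]) (R.add_ne_zero_of_mem_pos hcp hap.2)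
      (R.add_ne_zero_of_mem_pos hdp hap.2) with h1 | h1
    · rw [add_comm] at h1
      exact ⟨hab', a + c, ih ha hc h1, d, hd, by abel⟩
    · rw [add_comm] at h1
      have h2 : a + d ∈ R.bracketPow Ψ (n + 1) := ⟨R.add_mem_pos hap hdp h1, a, ha, d, hd, rfl⟩
      have h3 : a + (c + d) = a + d + c := by abel
      have h4 := ih h2 hc (by rwa [← h3])
      rw [h3]
      convert h4 using 2
      omega

/-- Write a + b = c + d with c in the previous power and d ∈ Ψ. As ‖a + b‖² > 0, a or b has positive
product with c or d, and their difference is zero or a root. Depending on its sign, the ideal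
property concludes, or induction applies to a decomposition of c. -/
theorem mem_bracketPow_or_mem_bracketPow (h : R.IsRootIdeal Ψ) {n m : ℕ} {a b : V}
    (ha : a ∈ R.pos) (hb : b ∈ R.pos) (hab : a + b ∈ R.bracketPow Ψ (n + m + 1)) :
    a ∈ R.bracketPow Ψ n ∨ b ∈ R.bracketPow Ψ m := by
  induction hN : n + m using Nat.strong_induction_on generalizing n m a b with
  | _ N ih =>
  -- The hypotheses are symmetric in a and b, so it suffices to treat positive products involving a.
  have key : ∀ {n m : ℕ} {a b c d : V}, n + m = N → a ∈ R.pos → b ∈ R.pos →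
      c ∈ R.bracketPow Ψ (n + m) → d ∈ Ψ → a + b = c + d → 0 < ⟪a, c⟫_ℝ ∨ 0 < ⟪a, d⟫_ℝ →
      a ∈ R.bracketPow Ψ n ∨ b ∈ R.bracketPow Ψ m := by
    intro n m a b c d hN ha hb hc hd he hin
    have hcp := (h.bracketPow _).subset_pos hc
    have hdp := h.subset_pos hd
    have hcn := h.bracketPow_antitone (Nat.le_add_right n m) hc
    have hcm := h.bracketPow_antitone (Nat.le_add_left m n) hc
    rcases hin with hin | hin
    · by_cases hac : a = c
      · exact Or.inl (hac ▸ hcn)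
      have hr := R.sub_mem_roots ha.1 hcp.1 hin hac
      rcases R.mem_pos_or_neg_mem_pos hr with hp | hp
      · have : c + (a - c) = a := by abel
        exact Or.inl (this ▸ (h.bracketPow n).add_mem c hcn _ hp (this.symm ▸ ha.1))
      · have hde : -(a - c) + d = b := by rw [neg_sub, sub_add_eq_add_sub, ← he]; abel
        have hae : a + -(a - c) = c := by abel
        rcases m with - | m
        · have hde' : d + -(a - c) = b := by rw [add_comm, hde]
          exact Or.inr (hde' ▸ h.add_mem d hd _ hp (hde'.symm ▸ hb.1))
        · rcases ih (n + m) (by omega) ha hp (hae.symm ▸ hc) rfl with h1 | h1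
          · exact Or.inl h1
          · exact Or.inr ⟨hb, _, h1, d, hd, hde.symm⟩
    · by_cases had : a = d
      · have : b = c := by rw [had, add_comm c] at he; exact add_left_cancel he
        exact Or.inr (this ▸ hcm)
      have hr := R.sub_mem_roots ha.1 hdp.1 hin had
      rcases R.mem_pos_or_neg_mem_pos hr with hp | hp
      · have hde : (a - d) + d = a := by abel
        have hbe : (a - d) + b = c := by rw [sub_add_eq_add_sub, he]; abel
        rcases n with - | n
        · have hde' : d + (a - d) = a := by abel
          exact Or.inl (hde' ▸ h.add_mem d hd _ hp (hde'.symm ▸ ha.1))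
        · have hc' : (a - d) + b ∈ R.bracketPow Ψ (n + m + 1) := by
            rw [hbe]; convert hc using 2; omega
          rcases ih (n + m) (by omega) hp hb hc' rfl with h1 | h1
          · exact Or.inl ⟨ha, _, h1, d, hd, hde.symm⟩
          · exact Or.inr h1
      · have : c + -(a - d) = b := by rw [neg_sub, ← add_sub_assoc, ← he]; abel
        exact Or.inr (this ▸ (h.bracketPow m).add_mem c hcm _ hp (this.symm ▸ hb.1))
  obtain ⟨hr, c, hc, d, hd, he⟩ := hab
  have hpos := R.inner_self_pos hr.1
  have hsum : ⟪a + b, a + b⟫_ℝ = ⟪a, c⟫_ℝ + ⟪a, d⟫_ℝ + (⟪b, c⟫_ℝ + ⟪b, d⟫_ℝ) := by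
    conv_lhs => rw [inner_add_left, he, inner_add_right, inner_add_right]
  by_cases hin : 0 < ⟪a, c⟫_ℝ ∨ 0 < ⟪a, d⟫_ℝ
  · exact key hN ha hb hc hd he hin
  · refine (key ((add_comm m n).trans hN) hb ha (by rwa [add_comm]) hd (by rwa [add_comm]) ?_).symm
    by_contra! hc'
    push Not at hin
    linarith [hin.1, hin.2, hc'.1, hc'.2]

end IsRootIdeal

/-- Index n stands for the power n + 1, whose elements are sums of n + 1 positive roots. Hence only
finitely many powers are nonempty. -/
theorem height_lt_of_mem_bracketPow (h : R.IsRootIdeal Ψ) {n : ℕ} {α : V}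
    (hα : α ∈ R.bracketPow Ψ n) : n < R.height α := by
  induction n generalizing α with
  | zero => exact R.height_pos (h.subset_pos hα)
  | succ n ih =>
    obtain ⟨-, a, ha, b, hb, rfl⟩ := hα
    have h1 := R.height_pos (h.subset_pos hb)
    have h2 := ih ha
    rw [R.height_add ((h.bracketPow n).subset_pos ha).2 (h.subset_pos hb).2]
    omega

theorem mem_extendedPos_cases {x : V × ℝ}
    (hx : x ∈ R.extendedPos) : (∃ a, (a = 0 ∨ a ∈ R.pos) ∧ ∃ t : ℝ, 0 ≤ t ∧ x = (a, t)) ∨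
      ∃ a ∈ R.pos, ∃ n : ℕ, x = (-a, (n : ℝ) + 1) := by
  obtain ⟨⟨h1 | h1, h2⟩, h3⟩ := hx
  · obtain ⟨α, hα, n, rfl | rfl⟩ := mem_affinePos_iff_basePoint.2 ⟨⟨h1, h2⟩, h3⟩
    · exact Or.inl ⟨α, Or.inr hα, n, n.cast_nonneg, rfl⟩
    · exact Or.inr ⟨α, hα, n, rfl⟩
  · refine Or.inl ⟨0, Or.inl rfl, x.2, ?_, Prod.ext h1 rfl⟩
    simp only [affineEval, h1, inner_zero_left, zero_add] at h3
    exact h3.le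

namespace IsRootIdeal

theorem ellSet_subset_affinePos (h : R.IsRootIdeal Ψ) : R.ellSet Ψ ⊆ R.affinePos := by
  rintro _ ⟨n, α, hα, rfl⟩
  exact ⟨α, (h.bracketPow n).subset_pos hα, n, Or.inr rfl⟩

theorem finite_ellSet (h : R.IsRootIdeal Ψ) : (R.ellSet Ψ).Finite := by
  obtain ⟨M, hM⟩ := (R.finite_pos.image R.height).bddAbove
  refine ((R.finite_pos.prod (Set.finite_Iic M)).image
    (fun p : V × ℕ => (-p.1, (p.2 : ℝ) + 1))).subset ?_
  rintro _ ⟨n, α, hα, rfl⟩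
  have hp := (h.bracketPow n).subset_pos hα
  refine ⟨(α, n), ⟨hp, ?_⟩, rfl⟩
  exact (height_lt_of_mem_bracketPow h hα).le.trans (hM (Set.mem_image_of_mem _ hp))

theorem ellSet_closed (h : R.IsRootIdeal Ψ) : ∀ x ∈ R.ellSet Ψ, ∀ y ∈ R.ellSet Ψ,
    x + y ∈ R.extendedRoots → x + y ∈ R.ellSet Ψ := by
  rintro _ ⟨n, a, ha, rfl⟩ _ ⟨m, b, hb, rfl⟩ ⟨hxy, -⟩
  have hne := R.add_ne_zero_of_mem_pos ((h.bracketPow n).subset_pos ha)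
    ((h.bracketPow m).subset_pos hb).2
  simp only [Prod.mk_add_mk, ← neg_add] at hxy ⊢
  have hab : a + b ∈ R.roots := hxy.elim R.neg_mem_roots_iff.1 fun h0 =>
    absurd (neg_eq_zero.1 h0) hne
  refine ⟨n + m + 1, a + b, h.add_mem_bracketPow ha hb hab, ?_⟩
  congr 1
  push_cast
  ring

/-- A summand with nonnegative gradient a forces y = (m + 1)δ - b with b = c + a and m ≤ k. The
ideal property keeps b in the k-th set, and the powers decrease. -/
theorem mem_ellSet_of_add_mem (h : R.IsRootIdeal Ψ) {a : V} (ha : a = 0 ∨ a ∈ R.pos) {t : ℝ}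
    (ht : 0 ≤ t) {y : V × ℝ} (hy : y ∈ R.extendedPos) (hay : (a, t) + y ∈ R.ellSet Ψ) :
    y ∈ R.ellSet Ψ := by
  obtain ⟨k, c, hc, he⟩ := hay
  have hcp := (h.bracketPow k).subset_pos hc
  have hac : a ∈ AddSubmonoid.closure R.simple := by
    rcases ha with rfl | ha
    · exact zero_mem _
    · exact ha.2
  rcases mem_extendedPos_cases hy with ⟨b, hb, s, hs, rfl⟩ | ⟨b, hb, m, rfl⟩
  · have hbc : b ∈ AddSubmonoid.closure R.simple := by
      rcases hb with rfl | hb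
      · exact zero_mem _
      · exact hb.2
    have h1 : a + b = -c := congrArg Prod.fst he
    exact absurd (by rw [h1]; simp) (R.add_ne_zero_of_mem_pos hcp (AddSubmonoid.add_mem _ hac hbc))
  · have h1 : a + -b = -c := congrArg Prod.fst he
    have h2 : t + ((m : ℝ) + 1) = k + 1 := congrArg Prod.snd he
    have hb' : c + a = b := by rw [← neg_eq_iff_eq_neg.2 h1]; abel
    refine ⟨m, b, ?_, rfl⟩
    have hmk : m ≤ k := by
      have : (m : ℝ) ≤ k := by linarith
      exact_mod_cast this
    refine h.bracketPow_antitone hmk ?_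
    rcases ha with rfl | ha
    · rwa [← hb', add_zero]
    · rw [← hb']
      exact (h.bracketPow k).add_mem c hc a ha (hb' ▸ hb.1)

theorem ellSet_coclosed (h : R.IsRootIdeal Ψ) : ∀ x ∈ R.extendedPos, ∀ y ∈ R.extendedPos,
    x + y ∈ R.ellSet Ψ → x ∈ R.ellSet Ψ ∨ y ∈ R.ellSet Ψ := by
  intro x hx y hy hxy
  rcases mem_extendedPos_cases hx with ⟨a, ha, t, ht, rfl⟩ | ⟨a, ha, n, rfl⟩
  · exact Or.inr (h.mem_ellSet_of_add_mem ha ht hy hxy)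
  rcases mem_extendedPos_cases hy with ⟨b, hb, t, ht, rfl⟩ | ⟨b, hb, m, rfl⟩
  · exact Or.inl (h.mem_ellSet_of_add_mem hb ht hx (by rwa [add_comm]))
  obtain ⟨k, c, hc, he⟩ := hxy
  have h1 : -a + -b = -c := congrArg Prod.fst he
  have h2 : (n : ℝ) + 1 + ((m : ℝ) + 1) = k + 1 := congrArg Prod.snd he
  have hk : k = n + m + 1 := by
    have : (k : ℝ) = (n + m + 1 : ℕ) := by push_cast; linarith
    exact_mod_cast this
  have hab : c = a + b := by rw [← neg_eq_iff_eq_neg.2 h1]; abel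
  subst hk hab
  exact (h.mem_bracketPow_or_mem_bracketPow ha hb hc).imp (fun h => ⟨n, a, h, rfl⟩)
    fun h => ⟨m, b, h, rfl⟩

theorem exists_inversionSet_eq_ellSet (h : R.IsRootIdeal Ψ) :
    ∃ w : R.affineWeylGroup, R.inversionSet w = R.ellSet Ψ :=
  exists_inversionSet_eq h.finite_ellSet h.ellSet_subset_affinePos h.ellSet_closed
    h.ellSet_coclosed

end IsRootIdeal

end RootIdeals

/-! ### Alcoves, Shi regions and sign types. -/

section ShiRegions

variable {V : Type*} [NormedAddCommGroup V] [InnerProductSpace ℝ V] {R : EuclideanRootSystem V}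

theorem inner_pos_of_mem_chamber {x : V} (hx : x ∈ R.chamber) {α : V} (hα : α ∈ R.pos) :
    0 < ⟪x, α⟫_ℝ := by
  have h : ∀ v ∈ AddSubmonoid.closure R.simple, v = 0 ∨ 0 < ⟪x, v⟫_ℝ := by
    intro v hv
    induction hv using AddSubmonoid.closure_induction with
    | mem v hv => exact Or.inr (hx v hv)
    | zero => exact Or.inl rfl
    | add u v _ _ hu hv =>
      rcases hu with rfl | hu
      · rwa [zero_add]
      rcases hv with rfl | hv
      · rw [add_zero]; exact Or.inr hu
      · rw [inner_add_right]; exact Or.inr (add_pos hu hv)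
  exact (h α hα.2).resolve_left (R.ne_zero_of_mem_roots hα.1)

/-- An alcove lies between two consecutive hyperplanes in each root direction. -/
theorem exists_lt_inner_lt [FiniteDimensional ℝ V] (w : R.affineWeylGroup) {α : V}
    (hα : α ∈ R.roots) : ∃ k : ℤ, ∀ x ∈ R.alcove w, (k : ℝ) < ⟪x, α⟫_ℝ ∧ ⟪x, α⟫_ℝ < k + 1 := by
  have hα' : (α, (0 : ℝ)) ∈ R.affineRoots := ⟨hα, 0, by simp⟩
  obtain ⟨hr, n, hn⟩ := (affineAction_mem_affineRoots_iff (inv_mem w.2)).2 hα'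
  have heval : ∀ y, ⟪(w : V ≃ᵃⁱ[ℝ] V) y, α⟫_ℝ =
      ⟪(affineAction (w : V ≃ᵃⁱ[ℝ] V)⁻¹ (α, (0 : ℝ))).1, y⟫_ℝ + n := by
    intro y
    rw [← hn]
    have := affineEval_affineAction_inv (w : V ≃ᵃⁱ[ℝ] V) (α, (0 : ℝ)) y
    simp only [affineEval, add_zero] at this
    rw [this, real_inner_comm]
  rcases R.mem_pos_or_neg_mem_pos hr with hp | hp
  · refine ⟨n, ?_⟩
    rintro _ ⟨y, hy, rfl⟩
    have h := hy _ hp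
    rw [real_inner_comm] at h
    rw [heval]
    constructor <;> linarith
  · refine ⟨n - 1, ?_⟩
    rintro _ ⟨y, hy, rfl⟩
    have h := hy _ hp
    rw [real_inner_comm, inner_neg_left] at h
    rw [heval]
    push_cast
    constructor <;> linarith

theorem lt_inner_lt_shiCoeff [FiniteDimensional ℝ V] (w : R.affineWeylGroup) {α : V}
    (hα : α ∈ R.roots) {x : V} (hx : x ∈ R.alcove w) :
    (R.shiCoeff w α : ℝ) < ⟪x, α⟫_ℝ ∧ ⟪x, α⟫_ℝ < R.shiCoeff w α + 1 :=
  Classical.epsilon_spec (exists_lt_inner_lt w hα) x hx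

theorem alcove_nonempty [FiniteDimensional ℝ V] (w : R.affineWeylGroup) : (R.alcove w).Nonempty :=
  ⟨_, Set.mem_image_of_mem _ R.basePoint_mem⟩

theorem convex_postnikovRegion (A : Set V) : Convex ℝ (R.postnikovRegion A) := by
  intro x hx y hy s t hs ht hst
  have hlt : ∀ {u v c : ℝ}, c < u → c < v → c < s * u + t * v := by
    intro u v c hu hv
    have := convex_Ioi c (Set.mem_Ioi.2 hu) (Set.mem_Ioi.2 hv) hs ht hst
    simpa using this
  refine ⟨fun α hα => ?_, fun β hβ => ⟨fun h => ?_, fun h => ?_⟩⟩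
  · rw [inner_add_left, real_inner_smul_left, real_inner_smul_left]
    exact hlt (hx.1 α hα) (hy.1 α hα)
  · rw [inner_add_right, real_inner_smul_right, real_inner_smul_right]
    exact hlt ((hx.2 β hβ).1 h) ((hy.2 β hβ).1 h)
  · have := hlt (neg_lt_neg ((hx.2 β hβ).2 h)) (neg_lt_neg ((hy.2 β hβ).2 h))
    rw [inner_add_right, real_inner_smul_right, real_inner_smul_right]
    linarith

theorem postnikovRegion_subset_shiComplement (A : Set V) :
    R.postnikovRegion A ⊆ R.shiComplement := by
  intro x hx α hα
  simp only [hyperplane, Set.mem_ofPred_eq, Int.cast_zero, Int.cast_one]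
  refine ⟨(inner_pos_of_mem_chamber hx.1 hα).ne', ?_⟩
  have h := hx.2 α hα
  rw [real_inner_comm] at h
  by_cases hA : ∃ a ∈ A, R.RootLE a α
  · exact (h.1 hA).ne'
  · exact (h.2 hA).ne

/-- The region is convex, hence inside the component. Conversely ⟨·, α⟩ has interval image on the
component and avoids 0 and 1, so the defining strict inequalities at x persist. -/
theorem connectedComponentIn_shiComplement_eq {A : Set V} {x : V}
    (hx : x ∈ R.postnikovRegion A) :
    connectedComponentIn R.shiComplement x = R.postnikovRegion A := by
  refine Set.Subset.antisymm ?_ ((convex_postnikovRegion A).isPreconnected.subset_connectedComponentIn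
    hx (postnikovRegion_subset_shiComplement A))
  intro y hy
  have hpc : IsPreconnected (connectedComponentIn R.shiComplement x) :=
    isPreconnected_connectedComponentIn
  have hxc : x ∈ connectedComponentIn R.shiComplement x :=
    mem_connectedComponentIn (postnikovRegion_subset_shiComplement A hx)
  have hsub : connectedComponentIn R.shiComplement x ⊆ R.shiComplement :=
    connectedComponentIn_subset _ _
  have key : ∀ α ∈ R.pos, ∀ c : ℝ, c = 0 ∨ c = 1 → ∀ u ∈ connectedComponentIn R.shiComplement x,
      ∀ v ∈ connectedComponentIn R.shiComplement x, c < ⟪u, α⟫_ℝ → c < ⟪v, α⟫_ℝ := by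
    intro α hα c hc u hu v hv huc
    by_contra! hvc
    have hord := (hpc.image (fun z => ⟪z, α⟫_ℝ) (by fun_prop)).ordConnected
    obtain ⟨z, hz, hzc⟩ := hord.out (Set.mem_image_of_mem _ hv) (Set.mem_image_of_mem _ hu)
      ⟨hvc, huc.le⟩
    have := hsub hz α hα
    simp only [hyperplane, Set.mem_ofPred_eq, Int.cast_zero, Int.cast_one] at this
    rcases hc with rfl | rfl
    · exact this.1 hzc
    · exact this.2 hzc
  refine ⟨fun α hα => ?_, fun β hβ => ⟨fun h => ?_, fun h => ?_⟩⟩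
  · exact key α (R.simple_subset_pos hα) 0 (Or.inl rfl) x hxc y hy (hx.1 α hα)
  · rw [real_inner_comm]
    have := (hx.2 β hβ).1 h
    rw [real_inner_comm] at this
    exact key β hβ 1 (Or.inr rfl) x hxc y hy this
  · by_contra! hc
    have h1 := (hx.2 β hβ).2 h
    have h2 := (hsub hy β hβ).2
    simp only [hyperplane, Set.mem_ofPred_eq, Int.cast_one] at h2
    rw [real_inner_comm] at h1 hc
    exact (key β hβ 1 (Or.inr rfl) y hy x hxc (hc.lt_of_ne (Ne.symm h2))).not_gt h1

variable {Ψ : Set V} [FiniteDimensional ℝ V]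

theorem IsRootIdeal.exists_minimalRoots_rootLE_iff (h : R.IsRootIdeal Ψ) {β : V}
    (hβ : β ∈ R.pos) : (∃ α ∈ R.minimalRoots Ψ, R.RootLE α β) ↔ β ∈ Ψ :=
  ⟨fun ⟨_, hα, hle⟩ => R.mem_of_rootLE h.subset_pos h.add_mem hα.1 hβ hle,
    fun hβ => R.exists_minimalRoots_rootLE h.subset_pos hβ⟩

theorem IsRootIdeal.mem_postnikovRegion_iff (h : R.IsRootIdeal Ψ) {x : V} :
    x ∈ R.postnikovRegion (R.minimalRoots Ψ) ↔ x ∈ R.chamber ∧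
      ∀ β ∈ R.pos, (β ∈ Ψ → 1 < ⟪x, β⟫_ℝ) ∧ (β ∉ Ψ → ⟪x, β⟫_ℝ < 1) := by
  refine and_congr_right fun _ => forall₂_congr fun β hβ => ?_
  rw [h.exists_minimalRoots_rootLE_iff hβ, real_inner_comm]

/-- Only low δ-coefficients matter: α + 0δ is never in 𝕃_Ψ, which gives dominance, and δ - β is in
it exactly when β ∈ Ψ, which places the alcove relative to H_{β,1}. -/
theorem IsRootIdeal.alcove_subset_postnikovRegion (h : R.IsRootIdeal Ψ) {w : R.affineWeylGroup}
    (hw : R.inversionSet w = R.ellSet Ψ) :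
    R.alcove w ⊆ R.postnikovRegion (R.minimalRoots Ψ) := by
  rintro _ ⟨y, hy, rfl⟩
  rw [h.mem_postnikovRegion_iff]
  have hiff : ∀ γ ∈ R.affinePos,
      γ ∈ R.ellSet Ψ ↔ affineEval γ ((w : V ≃ᵃⁱ[ℝ] V) y) < 0 := fun γ hγ => by
    rw [← hw, mem_inversionSet_iff hy, and_iff_right hγ]
  have hpos : ∀ γ ∈ R.affinePos, γ ∉ R.ellSet Ψ → 0 < affineEval γ ((w : V ≃ᵃⁱ[ℝ] V) y) :=
    fun γ hγ hn => (not_lt.1 (mt (hiff γ hγ).2 hn)).lt_of_ne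
      (affineEval_apply_ne_zero w.2 hy (affineRoots_of_mem_affinePos hγ)).symm
  refine ⟨fun α hα => ?_, fun β hβ => ⟨fun hβΨ => ?_, fun hβΨ => ?_⟩⟩
  · have hα' := R.simple_subset_pos hα
    have := hpos (α, 0) ⟨α, hα', 0, Or.inl (by simp)⟩ ?_
    · simpa [affineEval, real_inner_comm] using this
    · rintro ⟨n, b, -, hb⟩
      have : (0 : ℝ) = n + 1 := congrArg Prod.snd hb
      have : (0 : ℝ) ≤ n := n.cast_nonneg
      linarith
  · have := (hiff (-β, 1) ⟨β, hβ, 0, Or.inr (by simp)⟩).1 ⟨0, β, hβΨ, by simp⟩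
    simp only [affineEval, inner_neg_left] at this
    rw [real_inner_comm]
    linarith
  · have := hpos (-β, 1) ⟨β, hβ, 0, Or.inr (by simp)⟩ ?_
    · simp only [affineEval, inner_neg_left] at this
      rw [real_inner_comm]
      linarith
    · rintro ⟨n, b, hb, he⟩
      have h1 : (1 : ℝ) = n + 1 := congrArg Prod.snd he
      have h2 : -β = -b := congrArg Prod.fst he
      have h3 : n = 0 := by
        have : (n : ℝ) = 0 := by linarith
        exact_mod_cast this
      subst h3
      exact hβΨ (neg_inj.1 h2 ▸ hb)

theorem IsRootIdeal.signType_eq (h : R.IsRootIdeal Ψ) {w : R.affineWeylGroup}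
    (hw : R.alcove w ⊆ R.postnikovRegion (R.minimalRoots Ψ)) (α : R.pos) :
    ((α : V) ∈ Ψ → R.signType w α = 1) ∧ ((α : V) ∉ Ψ → R.signType w α = 0) := by
  obtain ⟨x, hx⟩ := alcove_nonempty w
  obtain ⟨h1, h2⟩ := lt_inner_lt_shiCoeff w α.2.1 hx
  obtain ⟨h3, h4⟩ := h.mem_postnikovRegion_iff.1 (hw hx)
  have h5 := h4 α α.2
  have h6 := inner_pos_of_mem_chamber h3 α.2
  constructor
  · intro hα
    have h7 := h5.1 hα
    have : (0 : ℝ) < R.shiCoeff w α := by linarith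
    exact sign_pos (by exact_mod_cast this)
  · intro hα
    have h7 := h5.2 hα
    have h8 : (-1 : ℝ) < R.shiCoeff w α := by linarith
    have h9 : (R.shiCoeff w α : ℝ) < 1 := by linarith
    have h8' : -1 < R.shiCoeff w α := by exact_mod_cast h8
    have h9' : R.shiCoeff w α < 1 := by exact_mod_cast h9
    have h0 : R.shiCoeff w α = 0 := by omega
    rw [signType, h0, sign_zero]

theorem IsRootIdeal.exists_affineWeylGroup_shiRegion_signType (h : R.IsRootIdeal Ψ) :
    ∃ w : R.affineWeylGroup,
      (∀ w' : R.affineWeylGroup, R.inversionSet w' = R.ellSet Ψ ↔ w' = w) ∧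
      (∃ S : Set V, R.IsShiRegion S ∧ R.alcove w ⊆ S ∧
        (∀ S' : Set V, R.IsShiRegion S' → R.alcove w ⊆ S' → S' = S) ∧
        R.IsDominant S ∧ S = R.postnikovRegion (R.minimalRoots Ψ)) ∧
      ∃ X : R.pos → SignType,
        R.HasSignType (R.postnikovRegion (R.minimalRoots Ψ)) X ∧
        (∀ α : R.pos, (α : V) ∈ Ψ → X α = 1) ∧ (∀ α : R.pos, (α : V) ∉ Ψ → X α = 0) := by
  obtain ⟨w, hw⟩ := h.exists_inversionSet_eq_ellSet
  have hsub := h.alcove_subset_postnikovRegion hw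
  obtain ⟨x, hx⟩ := alcove_nonempty w
  have hcomp := connectedComponentIn_shiComplement_eq (hsub hx)
  refine ⟨w, fun w' => ⟨fun hw' => inversionSet_injective (hw'.trans hw.symm), fun he => he ▸ hw⟩,
    ⟨_, ⟨x, postnikovRegion_subset_shiComplement _ (hsub hx), hcomp.symm⟩, hsub, ?_,
      fun y hy => hy.1, rfl⟩, R.signType w, ⟨⟨w, hsub⟩, fun w' hw' => ?_⟩,
    fun α => (h.signType_eq hsub α).1, fun α => (h.signType_eq hsub α).2⟩
  · rintro _ ⟨y, -, rfl⟩ hS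
    rw [connectedComponentIn_eq (hS hx), hcomp]
  · funext α
    by_cases hα : (α : V) ∈ Ψ
    · rw [(h.signType_eq hw' α).1 hα, (h.signType_eq hsub α).1 hα]
    · rw [(h.signType_eq hw' α).2 hα, (h.signType_eq hsub α).2 hα]

end ShiRegions

end EuclideanRootSystem

/-! ### Lie algebra side: ideals of the Borel subalgebra and their root spaces. -/

section RootSpaces

open LieAlgebra LieAlgebra.IsKilling LieModule

variable {K L : Type*} [Field K] [CharZero K] [LieRing L] [LieAlgebra K L] [FiniteDimensional K L]
  [IsKilling K L] {H : LieSubalgebra K L} [H.IsCartanSubalgebra]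
  [LieModule.IsTriangularizable K H L]

theorem exists_smul_eq_of_mem_rootSpace {α : Weight K H L} (hα : α.IsNonZero) {x y : L}
    (hx : x ∈ rootSpace H α) (hx0 : x ≠ 0) (hy : y ∈ rootSpace H α) : ∃ c : K, c • x = y := by
  have h := (finrank_eq_one_iff_of_nonzero' (⟨x, hx⟩ : rootSpace H α)
    (by simpa using hx0)).1 (finrank_rootSpace_eq_one α hα) ⟨y, hy⟩
  obtain ⟨c, hc⟩ := h
  exact ⟨c, congrArg Subtype.val hc⟩

/-- The bracket of nonzero vectors in two root spaces is nonzero if the sum is a root. -/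
theorem lie_ne_zero_of_mem_rootSpace {α β : Weight K H L} (hα : α.IsNonZero) (hβ : β.IsNonZero)
    (hαβ : rootSpace H (⇑α + ⇑β) ≠ ⊥) {x y : L} (hx : x ∈ rootSpace H α) (hx0 : x ≠ 0)
    (hy : y ∈ rootSpace H β) (hy0 : y ≠ 0) : ⁅x, y⁆ ≠ 0 := by
  obtain ⟨h, e, f, ht, he, hf⟩ := exists_isSl2Triple_of_weight_isNonZero hα
  obtain rfl := ht.h_eq_coroot hα he hf
  obtain ⟨v, hv, hv0⟩ := (chainTop α β).exists_ne_zero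
  have prim : ht.HasPrimitiveVectorWith v (chainLength α β : K) :=
    have := lie_mem_genWeightSpace_of_mem_genWeightSpace he hv
    ⟨hv0, (chainLength_smul _ _ hv).symm, by rwa [genWeightSpace_add_chainTop _ _ hα] at this⟩
  have htop := ((rootSpace_zsmul_add_ne_bot_iff α β hα 1).1 (by rwa [one_smul])).1
  have hle := chainTopCoeff_le_chainLength α β
  obtain ⟨k, hk⟩ : ∃ k : ℕ, chainTopCoeff α β = k + 1 := ⟨chainTopCoeff α β - 1, by omega⟩
  -- Since α + β is a weight, β lies k + 1 ≥ 1 steps below the top of its α-chain. So y is a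
  -- multiple of f^(k+1) v, and e sends f^(k+1) v to (k + 1)(`chainLength α β` - k) f^k v.
  have hu := toEnd_pow_apply_mem hf hv (k + 1)
  have hw : ((k + 1) • (-α : H → K) + chainTop α β) = β := by
    rw [coe_chainTop', ← hk, smul_neg, neg_add_cancel_left]
  rw [hw] at hu
  have hu0 := prim.pow_toEnd_f_ne_zero_of_eq_nat rfl (by omega : k + 1 ≤ chainLength α β)
  have hk0 := prim.pow_toEnd_f_ne_zero_of_eq_nat rfl (by omega : k ≤ chainLength α β)
  obtain ⟨c, rfl⟩ := exists_smul_eq_of_mem_rootSpace hα he ht.e_ne_zero hx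
  obtain ⟨d, rfl⟩ := exists_smul_eq_of_mem_rootSpace hβ hu hu0 hy
  rw [smul_lie, lie_smul, prim.lie_e_pow_succ_toEnd_f]
  have hne : ((k : K) + 1) * (chainLength α β - k) ≠ 0 := by
    refine mul_ne_zero (by exact_mod_cast k.succ_ne_zero) (sub_ne_zero.2 ?_)
    exact_mod_cast (by omega : chainLength α β ≠ k)
  exact smul_ne_zero (left_ne_zero_of_smul hx0) (smul_ne_zero (left_ne_zero_of_smul hy0)
    (smul_ne_zero hne hk0))

/-- The sum of the positive root spaces. -/
def positivePart (b : (rootSystem H).Base) : LieSubmodule K H L :=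
  ⨆ (α : H.root) (_ : b.IsPos α), rootSpace H (α : Weight K H L)

theorem rootSpace_le_positivePart {b : (rootSystem H).Base} {α : H.root} (hα : b.IsPos α) :
    rootSpace H (α : Weight K H L) ≤ positivePart b :=
  le_iSup₂_of_le α hα le_rfl

theorem rootSpace_le_borelSubalgebra {b : (rootSystem H).Base} {α : H.root} (hα : b.IsPos α) :
    (rootSpace H (α : Weight K H L)).toSubmodule ≤ (borelSubalgebra b).toSubmodule :=
  le_sup_of_le_right (le_iSup₂_of_le α hα le_rfl)

theorem mem_borelSubalgebra_iff {b : (rootSystem H).Base} {x : L} :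
    x ∈ borelSubalgebra b ↔ ∃ h ∈ H, ∃ n ∈ positivePart b, h + n = x := by
  rw [← LieSubalgebra.mem_toSubmodule]
  change x ∈ H.toSubmodule ⊔ ⨆ (α : H.root) (_ : b.IsPos α),
    (rootSpace H (α : Weight K H L)).toSubmodule ↔ _
  rw [Submodule.mem_sup]
  simp only [positivePart, ← LieSubmodule.mem_toSubmodule, LieSubmodule.iSup_toSubmodule,
    LieSubalgebra.mem_toSubmodule]

theorem lie_mem_positivePart {b : (rootSystem H).Base} {x y : L} (hx : x ∈ positivePart b)
    (hy : y ∈ positivePart b) : ⁅x, y⁆ ∈ positivePart b := by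
  have key : ∀ α : H.root, b.IsPos α → ∀ β : H.root, b.IsPos β →
      ∀ u ∈ rootSpace H (α : Weight K H L), ∀ v ∈ rootSpace H (β : Weight K H L),
      ⁅u, v⁆ ∈ positivePart b := by
    intro α hα β hβ u hu v hv
    have huv : ⁅u, v⁆ ∈ rootSpace H (⇑(α : Weight K H L) + ⇑(β : Weight K H L)) :=
      lie_mem_genWeightSpace_of_mem_genWeightSpace hu hv
    by_cases hbot : rootSpace H (⇑(α : Weight K H L) + ⇑(β : Weight K H L)) = ⊥
    · rw [hbot, LieSubmodule.mem_bot] at huv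
      rw [huv]
      exact zero_mem _
    -- Two positive roots cannot sum to zero, since opposite roots have opposite heights; thus no
    -- bracket falls into `𝔥`.
    have hne : ¬ ((⟨_, hbot⟩ : Weight K H L)).IsZero := by
      intro hz
      have hz' : ⇑(α : Weight K H L) + ⇑(β : Weight K H L) = 0 := hz
      have hβ' : β = (rootSystem H).reflectionPerm α α := by
        apply (rootSystem H).root.injective
        rw [RootPairing.root_reflectionPerm, RootPairing.reflection_apply_self]
        ext h
        have := congrFun hz' h
        simp only [Pi.add_apply, Pi.zero_apply] at this
        simpa using eq_neg_of_add_eq_zero_right this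
      rw [RootPairing.Base.isPos_iff] at hα hβ
      have hneg : b.height ((rootSystem H).reflectionPerm α α) = -b.height α :=
        RootPairing.Base.height_reflectionPerm_self b α
      rw [hβ', hneg] at hβ
      omega
    have hpos : b.IsPos (⟨⟨_, hbot⟩, by simpa using hne⟩ : H.root) :=
      RootPairing.Base.IsPos.add hα hβ (by ext h; simp)
    exact rootSpace_le_positivePart hpos huv
  have hsmul : ∀ α : H.root, b.IsPos α → ∀ u ∈ rootSpace H (α : Weight K H L),
      ∀ v ∈ positivePart b, ⁅u, v⁆ ∈ positivePart b := by
    intro α hα u hu v hv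
    have hle : (positivePart b).toSubmodule ≤
        (positivePart b).toSubmodule.comap (LieAlgebra.ad K L u) := by
      conv_lhs => rw [positivePart]
      simp only [LieSubmodule.iSup_toSubmodule, iSup_le_iff]
      intro β hβ v hv
      exact key α hα β hβ u hu v hv
    exact hle hv
  have hle : (positivePart b).toSubmodule ≤
      (positivePart b).toSubmodule.comap (-LieAlgebra.ad K L y) := by
    conv_lhs => rw [positivePart]
    simp only [LieSubmodule.iSup_toSubmodule, iSup_le_iff]
    intro α hα u hu
    change -⁅y, u⁆ ∈ positivePart b
    rw [lie_skew]
    exact hsmul α hα u hu y hy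
  have : -⁅y, x⁆ ∈ positivePart b := hle hx
  rwa [lie_skew] at this

theorem lie_mem_positivePart_of_mem_borelSubalgebra {b : (rootSystem H).Base} {x y : L}
    (hx : x ∈ borelSubalgebra b) (hy : y ∈ borelSubalgebra b) : ⁅x, y⁆ ∈ positivePart b := by
  obtain ⟨h, hh, n, hn, rfl⟩ := mem_borelSubalgebra_iff.1 hx
  obtain ⟨h', hh', n', hn', rfl⟩ := mem_borelSubalgebra_iff.1 hy
  have h0 : ⁅h, h'⁆ = 0 :=
    congrArg Subtype.val (LieModule.IsTrivial.trivial (⟨h, hh⟩ : H) (⟨h', hh'⟩ : H))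
  rw [add_lie, lie_add, lie_add, h0, zero_add]
  refine add_mem ((positivePart b).lie_mem (x := ⟨h, hh⟩) hn') (add_mem ?_
    (lie_mem_positivePart hn hn'))
  rw [← lie_skew]
  exact neg_mem ((positivePart b).lie_mem (x := ⟨h', hh'⟩) hn)

theorem disjoint_rootSpace_positivePart {b : (rootSystem H).Base} {χ : Weight K H L}
    (hχ : ∀ α : H.root, b.IsPos α → (α : Weight K H L) ≠ χ) :
    Disjoint (rootSpace H χ) (positivePart b) :=
  (iSupIndep_genWeightSpace' K H L χ).mono_right <| iSup₂_le fun α hα =>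
    le_iSup₂_of_le (α : Weight K H L) (hχ α hα) le_rfl

variable {b : (rootSystem H).Base} {J : LieIdeal K (borelSubalgebra b)}

theorem mem_idealSubspace_iff {x : L} :
    x ∈ idealSubspace b J ↔ ∃ hx : x ∈ borelSubalgebra b, (⟨x, hx⟩ : borelSubalgebra b) ∈ J := by
  constructor
  · rintro ⟨y, hy, rfl⟩
    exact ⟨y.2, hy⟩
  · rintro ⟨hx, h⟩
    exact ⟨_, h, rfl⟩

theorem lie_mem_idealSubspace {x y : L} (hx : x ∈ borelSubalgebra b)
    (hy : y ∈ idealSubspace b J) : ⁅x, y⁆ ∈ idealSubspace b J := by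
  obtain ⟨hy, hyJ⟩ := mem_idealSubspace_iff.1 hy
  exact mem_idealSubspace_iff.2
    ⟨_, J.lie_mem (x := (⟨x, hx⟩ : borelSubalgebra b)) (m := ⟨y, hy⟩) hyJ⟩

variable (b J) in
/-- An ideal of the Borel subalgebra, as a module over the Cartan subalgebra. -/
def idealWeightModule : LieSubmodule K H L where
  toSubmodule := idealSubspace b J
  lie_mem {x _} hm := lie_mem_idealSubspace
    (mem_borelSubalgebra_iff.2 ⟨x, x.2, 0, zero_mem _, add_zero _⟩) hm

theorem IsAdNilpotentIdeal.le_positivePart (hJ : IsAdNilpotentIdeal b J) :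
    idealWeightModule b J ≤ positivePart b := by
  have hle : (⁅(⊤ : LieIdeal K (borelSubalgebra b)),
      (⊤ : LieIdeal K (borelSubalgebra b))⁆).toSubmodule ≤
      (positivePart b).toSubmodule.comap (borelSubalgebra b).toSubmodule.subtype := by
    rw [LieSubmodule.lieIdeal_oper_eq_linear_span, Submodule.span_le]
    rintro _ ⟨⟨x, -⟩, ⟨y, -⟩, rfl⟩
    exact lie_mem_positivePart_of_mem_borelSubalgebra x.2 y.2
  rintro _ ⟨x, hx, rfl⟩
  exact hle (hJ hx)

/-- As an `𝔥`-submodule, `J` is the sum of its intersections with the weight spaces. Such an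
intersection is zero unless the weight is a positive root, and then it is zero or the whole line. -/
theorem IsAdNilpotentIdeal.idealSubspace_eq (hJ : IsAdNilpotentIdeal b J) :
    idealSubspace b J = ⨆ (α : H.root) (_ : b.IsPos α ∧
      (rootSpace H (α : Weight K H L)).toSubmodule ≤ idealSubspace b J),
      (rootSpace H (α : Weight K H L)).toSubmodule := by
  refine le_antisymm ?_ (iSup₂_le fun α hα => hα.2)
  change (idealWeightModule b J).toSubmodule ≤ _
  rw [eq_iSup_inf_genWeightSpace K H L (idealWeightModule b J), LieSubmodule.iSup_toSubmodule]
  refine iSup_le fun χ => ?_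
  by_cases hχ : ∃ α : H.root, b.IsPos α ∧ (α : Weight K H L) = χ
  · obtain ⟨α, hα, rfl⟩ := hχ
    by_cases hbot : idealWeightModule b J ⊓ rootSpace H (α : Weight K H L) = ⊥
    · rw [hbot]
      exact bot_le
    · obtain ⟨x, hx, hx0⟩ : ∃ x ∈ idealWeightModule b J ⊓ rootSpace H (α : Weight K H L), x ≠ 0 := by
        by_contra! hc
        exact hbot ((LieSubmodule.eq_bot_iff _).2 hc)
      refine le_iSup₂_of_le α ⟨hα, fun y hy => ?_⟩ inf_le_right
      obtain ⟨c, rfl⟩ := exists_smul_eq_of_mem_rootSpace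
        (LieSubalgebra.isNonZero_coe_root α) hx.2 hx0 hy
      exact Submodule.smul_mem _ c hx.1
  · push Not at hχ
    have : idealWeightModule b J ⊓ rootSpace H χ = ⊥ :=
      ((disjoint_rootSpace_positivePart hχ).symm.mono_left hJ.le_positivePart).eq_bot
    change (idealWeightModule b J ⊓ rootSpace H χ).toSubmodule ≤ _
    rw [this]
    exact bot_le

/-- If the root space of `α` lies in an ideal of the Borel subalgebra, so does the root space of
`α + β`, for `β` a positive root. -/
theorem rootSpace_le_idealSubspace_of_root_eq_add {α β γ : H.root}
    (hα : (rootSpace H (α : Weight K H L)).toSubmodule ≤ idealSubspace b J) (hβ : b.IsPos β)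
    (hγ : (rootSystem H).root γ = (rootSystem H).root α + (rootSystem H).root β) :
    (rootSpace H (γ : Weight K H L)).toSubmodule ≤ idealSubspace b J := by
  have hγ' : ⇑(γ : Weight K H L) = ⇑(β : Weight K H L) + ⇑(α : Weight K H L) := by
    funext h
    have := LinearMap.congr_fun hγ h
    simpa [add_comm] using this
  obtain ⟨x, hx, hx0⟩ := (α : Weight K H L).exists_ne_zero
  obtain ⟨y, hy, hy0⟩ := (β : Weight K H L).exists_ne_zero
  have hne := lie_ne_zero_of_mem_rootSpace (LieSubalgebra.isNonZero_coe_root β)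
    (LieSubalgebra.isNonZero_coe_root α) (hγ' ▸ (γ : Weight K H L).genWeightSpace_ne_bot)
    hy hy0 hx hx0
  have hmem := lie_mem_genWeightSpace_of_mem_genWeightSpace hy hx
  rw [← hγ'] at hmem
  intro z hz
  obtain ⟨c, rfl⟩ := exists_smul_eq_of_mem_rootSpace
    (LieSubalgebra.isNonZero_coe_root γ) hmem hne hz
  exact Submodule.smul_mem _ c
    (lie_mem_idealSubspace (rootSpace_le_borelSubalgebra hβ hy) (hα hx))

/-! ### Transport of sums and positivity to the Euclidean root system. -/

namespace RootIdentification

variable {V : Type*} [NormedAddCommGroup V] [InnerProductSpace ℝ V] {R : EuclideanRootSystem V}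
  (e : RootIdentification b R)

include e

theorem inner_eq (α β : H.root) : ⟪(e.toEquiv α : V), (e.toEquiv β : V)⟫_ℝ =
    ((rootSystem H).pairingIn ℤ α β : ℝ) *
      (⟪(e.toEquiv β : V), (e.toEquiv β : V)⟫_ℝ / 2) := by
  have h := R.inner_self_pos (e.toEquiv β).2
  rw [← e.pairing_eq]
  field_simp

theorem eq_zero_of_forall_inner_eq_zero {v : V}
    (h : ∀ δ : H.root, ⟪v, (e.toEquiv δ : V)⟫_ℝ = 0) : v = 0 := by
  have hle : Submodule.span ℝ R.roots ≤ LinearMap.ker (innerₛₗ ℝ v) := by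
    rw [Submodule.span_le]
    intro x hx
    have := h (e.toEquiv.symm ⟨x, hx⟩)
    rwa [Equiv.apply_symm_apply] at this
  rw [R.span_roots] at hle
  exact inner_self_eq_zero.1 (hle (Submodule.mem_top (x := v)))

/-- The identification is only a bijection preserving Cartan integers. These determine sums because
a vector is determined by its products with the spanning set of roots, and a functional on `𝔥` by
its values on the spanning coroots. -/
theorem root_eq_add_iff {α β γ : H.root} :
    (rootSystem H).root γ = (rootSystem H).root α + (rootSystem H).root β ↔
      (e.toEquiv γ : V) = e.toEquiv α + e.toEquiv β := by
  constructor
  · intro h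
    refine sub_eq_zero.1 (e.eq_zero_of_forall_inner_eq_zero fun δ => ?_)
    rw [inner_sub_left, inner_add_left, e.inner_eq α δ, e.inner_eq β δ, e.inner_eq γ δ,
      RootPairing.pairingIn_eq_add_of_root_eq_add h]
    push_cast
    ring
  · intro h
    refine LinearMap.ext_on (RootPairing.IsRootSystem.span_coroot_eq_top (P := rootSystem H)) ?_
    rintro _ ⟨δ, rfl⟩
    have h1 : (rootSystem H).pairingIn ℤ γ δ =
        (rootSystem H).pairingIn ℤ α δ + (rootSystem H).pairingIn ℤ β δ := by
      have hδ := R.inner_self_pos (e.toEquiv δ).2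
      have h2 := e.inner_eq γ δ
      rw [h, inner_add_left, e.inner_eq α δ, e.inner_eq β δ, ← add_mul] at h2
      exact_mod_cast (mul_right_cancel₀ (by positivity) h2).symm
    have h3 := congrArg (algebraMap ℤ K) h1
    rw [map_add, RootPairing.algebraMap_pairingIn, RootPairing.algebraMap_pairingIn,
      RootPairing.algebraMap_pairingIn] at h3
    simpa using h3

theorem toEquiv_reflectionPerm_self (α : H.root) :
    (e.toEquiv ((rootSystem H).reflectionPerm α α) : V) = -e.toEquiv α := by
  refine add_eq_zero_iff_eq_neg.1 (e.eq_zero_of_forall_inner_eq_zero fun δ => ?_)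
  rw [inner_add_left, e.inner_eq α δ, e.inner_eq _ δ, RootPairing.pairingIn_reflectionPerm_self_left]
  push_cast
  ring

theorem toEquiv_mem_pos {α : H.root} (hα : b.IsPos α) : (e.toEquiv α : V) ∈ R.pos := by
  refine ⟨(e.toEquiv α).2, ?_⟩
  refine hα.induction_on_add (p := fun i => (e.toEquiv i : V) ∈ AddSubmonoid.closure R.simple)
    (fun i hi => AddSubmonoid.subset_closure ((e.simple_iff i).2 hi)) fun i j k hk hi hj => ?_
  rw [e.root_eq_add_iff.1 hk]
  exact add_mem hi (AddSubmonoid.subset_closure ((e.simple_iff j).2 hj))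

/-- For the converse, a nonpositive α has a positive opposite, whose image would be both positive
and the negative of a positive root. -/
theorem isPos_iff [FiniteDimensional ℝ V] {α : H.root} :
    b.IsPos α ↔ (e.toEquiv α : V) ∈ R.pos := by
  refine ⟨e.toEquiv_mem_pos, fun h => ?_⟩
  rcases RootPairing.Base.IsPos.or_neg b α with hα | hα
  · exact hα
  · have := e.toEquiv_mem_pos hα
    rw [show (e.toEquiv (@Neg.neg _ (rootSystem H).indexNeg.toNeg α) : V) = -e.toEquiv α from
      e.toEquiv_reflectionPerm_self α] at this
    exact absurd this (R.neg_notMem_pos h)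

theorem mem_idealRoots_iff {α : H.root} : (e.toEquiv α : V) ∈ idealRoots e J ↔ b.IsPos α ∧
    (rootSpace H (α : Weight K H L)).toSubmodule ≤ idealSubspace b J := by
  constructor
  · rintro ⟨β, hβ, he, hle⟩
    obtain rfl := e.toEquiv.injective (Subtype.ext he)
    exact ⟨hβ, hle⟩
  · exact fun ⟨h, hle⟩ => ⟨α, h, rfl, hle⟩

variable (J) in
theorem isRootIdeal_idealRoots [FiniteDimensional ℝ V] : R.IsRootIdeal (idealRoots e J) := by
  constructor
  · rintro _ ⟨α, hα, rfl, -⟩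
    exact e.toEquiv_mem_pos hα
  · rintro _ ⟨α, hα, rfl, hle⟩ β hβ hr
    obtain ⟨β, rfl⟩ : ∃ β', (e.toEquiv β' : V) = β := ⟨e.toEquiv.symm ⟨β, hβ.1⟩, by simp⟩
    obtain ⟨γ, hγ⟩ : ∃ γ, (e.toEquiv γ : V) = e.toEquiv α + e.toEquiv β :=
      ⟨e.toEquiv.symm ⟨_, hr⟩, by simp⟩
    have hroot := e.root_eq_add_iff.2 hγ
    have hβ' := e.isPos_iff.2 hβ
    exact ⟨γ, hα.add hβ' hroot, hγ.symm,
      rootSpace_le_idealSubspace_of_root_eq_add hle hβ' hroot⟩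

end RootIdentification

end RootSpaces

end

/-! ### The main theorem. -/

open LieAlgebra LieAlgebra.IsKilling EuclideanRootSystem in
theorem mainTheorem2 {K L V : Type*} [Field K] [CharZero K] [LieRing L] [LieAlgebra K L]
    [FiniteDimensional K L] [IsSimple K L]
    (H : LieSubalgebra K L) [H.IsCartanSubalgebra] [LieModule.IsTriangularizable K H L]
    (b : (rootSystem H).Base)
    [NormedAddCommGroup V] [InnerProductSpace ℝ V] [FiniteDimensional ℝ V]
    (R : EuclideanRootSystem V) (e : RootIdentification b R)
    (J : LieIdeal K (borelSubalgebra b)) (hJ : IsAdNilpotentIdeal b J) :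
    -- the ideal is the sum of the root spaces of `Φ_J`
    (idealSubspace b J = ⨆ (α : H.root) (_ : (e.toEquiv α : V) ∈ idealRoots e J),
      (rootSpace H (α : LieModule.Weight K H L)).toSubmodule) ∧
    ∃ w : R.affineWeylGroup,
      -- `w = w_J` is the unique element with inversion set `𝕃_J`
      (∀ w' : R.affineWeylGroup,
        R.inversionSet w' = R.ellSet (idealRoots e J) ↔ w' = w) ∧
      -- the Shi region containing the alcove of `w_J` is dominant and equal to `R_J`
      (∃ S : Set V, R.IsShiRegion S ∧ R.alcove w ⊆ S ∧
        (∀ S' : Set V, R.IsShiRegion S' → R.alcove w ⊆ S' → S' = S) ∧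
        R.IsDominant S ∧ S = R.postnikovRegion (R.minimalRoots (idealRoots e J))) ∧
      -- the sign type of `R_J`
      ∃ X : R.pos → SignType,
        R.HasSignType (R.postnikovRegion (R.minimalRoots (idealRoots e J))) X ∧
        (∀ α : R.pos, (α : V) ∈ idealRoots e J → X α = 1) ∧
        (∀ α : R.pos, (α : V) ∉ idealRoots e J → X α = 0) := by
  have hideal := e.isRootIdeal_idealRoots J
  refine ⟨?_, hideal.exists_affineWeylGroup_shiRegion_signType⟩
  rw [hJ.idealSubspace_eq]
  simp only [e.mem_idealRoots_iff]
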